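/- Let $S^d=\{x\in\mathbb R^{d+1}:\|x\|=1\}$ with surface measure $d\omega$. For $\tau\in\mathbb R^{d+1}$ with all $\tau_i>-\tfrac12$ put $h_\tau(x)=\prod_{i=1}^{d+1}|x_i|^{\tau_i}$ and, for $0<p<\infty$, $\|F\|_{\tau,p}=\big(\int_{S^d}|F|^p\,h_\tau^2\,d\omega\big)^{1/p}\in[0,\infty]$. Let $\kappa\in\mathbb R^{d+1}$ with all $\kappa_i\ge 0$, and let $$V_\kappa g(y)=c_\kappa\int_{[-1,1]^{d+1}}g(y_1t_1,\dots,y_{d+1}t_{d+1})\prod_{i=1}^{d+1}(1+t_i)(1-t_i^2)^{\kappa_i-1}\,dt,$$ where $c_\kappa$ is determined by $V_\kappa 1=1$; if some $\kappa_i=0$, the normalized measure in the variable $t_i$ is replaced by its weak limit as $\kappa_i\to0^+$, the unit point mass at $t_i=1$. For $x\in S^d$ let $B(x,\theta)=\{z\in\mathbb R^{d+1}:\|z\|\le1,\ \langle x,z\rangle\ge\cos\theta\}$, and for measurable $f$ on $S^d$ define $$\mathcal M_\kappa f(x)=\sup_{0<\theta\le\pi}\frac{\int_{S^d}|f(y)|\,V_\kappa[\chi_{B(x,\theta)}](y)\,h_\kappa^2(y)\,d\omega(y)}{\int_{S^d}V_\kappa[\chi_{B(x,\theta)}](y)\,h_\kappa^2(y)\,d\omega(y)}\in[0,\infty].$$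 **Theorem.** Let $1<p<\infty$ and let $-\tfrac12<\tau_i<p\kappa_i+\tfrac{p-1}2$ for all $1\le i\le d+1$. Then there is a constant $c<\infty$, depending only on $d,\kappa,\tau,p$, such that for every sequence $\{f_j\}_{j=1}^\infty$ of measurable (real- or complex-valued) functions on $S^d$, $$\Big\|\Big(\sum_{j=1}^\infty(\mathcal M_\kappa f_j)^2\Big)^{1/2}\Big\|_{\tau,p}\le c\,\Big\|\Big(\sum_{j=1}^\infty|f_j|^2\Big)^{1/2}\Big\|_{\tau,p}.$$ -/

import Mathlib

open MeasureTheory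
open scoped ENNReal NNReal

noncomputable section

/-- The unit sphere `S^d` in the Euclidean space `ℝ^(d+1)`. -/
abbrev UnitSphere (d : ℕ) : Type :=
  Metric.sphere (0 : EuclideanSpace ℝ (Fin (d + 1))) 1

/-- The surface (Lebesgue) measure `dω` on `S^d`. -/
def surfaceMeasure (d : ℕ) : Measure (UnitSphere d) :=
  (volume : Measure (EuclideanSpace ℝ (Fin (d + 1)))).toSphere

/-- The product weight `h_τ(x) = ∏ i, |x_i| ^ τ_i`. -/
def productWeight {d : ℕ} (τ : Fin (d + 1) → ℝ) (x : EuclideanSpace ℝ (Fin (d + 1))) : ℝ :=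
  ∏ i, |x i| ^ τ i

/-- The measure `h_τ² dω` on `S^d`. -/
def weightedMeasure {d : ℕ} (τ : Fin (d + 1) → ℝ) : Measure (UnitSphere d) :=
  (surfaceMeasure d).withDensity fun x => ENNReal.ofReal (productWeight τ x ^ 2)

/-- The quantity `‖F‖_{τ,p} = (∫ F^p h_τ² dω)^(1/p)` of a function with values in `[0,∞]`. -/
def weightedNorm {d : ℕ} (τ : Fin (d + 1) → ℝ) (p : ℝ) (F : UnitSphere d → ℝ≥0∞) : ℝ≥0∞ :=
  (∫⁻ x, F x ^ p ∂(weightedMeasure τ)) ^ (1 / p)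

/-- The measure `(1 + t) (1 - t²)^(k-1) dt` on `[-1,1]`. -/
def intertwiningDensityMeasure (k : ℝ) : Measure ℝ :=
  (volume.restrict (Set.Icc (-1) 1)).withDensity fun t =>
    ENNReal.ofReal ((1 + t) * (1 - t ^ 2) ^ (k - 1))

open Classical in
/-- One coordinate of the measure representing the intertwining operator: for `k > 0` it is
`(1 + t) (1 - t²)^(k-1) dt` on `[-1,1]`, normalized to total mass one; for `k = 0` it is the weak
limit of these measures as `k → 0⁺`, the unit point mass at `1`. -/
def intertwiningMeasure (k : ℝ) : Measure ℝ :=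
  if k = 0 then Measure.dirac 1
  else (intertwiningDensityMeasure k Set.univ)⁻¹ • intertwiningDensityMeasure k

/-- The intertwining operator `V_κ` of the group `ℤ₂^(d+1)`, on functions with values in `[0,∞]`:
`V_κ g(y) = c_κ ∫ g(y_1 t_1, …, y_{d+1} t_{d+1}) ∏ i, (1 + t_i) (1 - t_i²)^(κ_i - 1) dt`. -/
def intertwiningOp {d : ℕ} (κ : Fin (d + 1) → ℝ)
    (g : EuclideanSpace ℝ (Fin (d + 1)) → ℝ≥0∞) (y : EuclideanSpace ℝ (Fin (d + 1))) : ℝ≥0∞ :=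
  ∫⁻ t : Fin (d + 1) → ℝ, g (WithLp.toLp 2 fun i => y i * t i)
    ∂(Measure.pi fun i => intertwiningMeasure (κ i))

/-- The solid cap `B(x,θ) = {z : ‖z‖ ≤ 1, ⟨x,z⟩ ≥ cos θ}`. -/
def solidCap {d : ℕ} (x : EuclideanSpace ℝ (Fin (d + 1))) (θ : ℝ) :
    Set (EuclideanSpace ℝ (Fin (d + 1))) :=
  {z | ‖z‖ ≤ 1 ∧ Real.cos θ ≤ inner ℝ x z}

/-- The maximal function `𝓜_κ f(x)`: the supremum over `0 < θ ≤ π` of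
`(∫ |f| V_κ[χ_{B(x,θ)}] h_κ² dω) / (∫ V_κ[χ_{B(x,θ)}] h_κ² dω)`, with values in `[0,∞]`. -/
def intertwiningMaximal {d : ℕ} {𝕜 : Type*} [RCLike 𝕜] (κ : Fin (d + 1) → ℝ)
    (f : UnitSphere d → 𝕜) (x : UnitSphere d) : ℝ≥0∞ :=
  ⨆ θ ∈ Set.Ioc 0 Real.pi,
    (∫⁻ y, ‖f y‖ₑ * intertwiningOp κ ((solidCap x.1 θ).indicator 1) y.1 ∂(weightedMeasure κ)) /
      ∫⁻ y, intertwiningOp κ ((solidCap x.1 θ).indicator 1) y.1 ∂(weightedMeasure κ)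

end

/-!
Fold the sphere by the reflections in the coordinate hyperplanes: equip it with the pseudometric
`max_i ||x_i| - |y_i||`. A ball of bounded radius `r` around `x` has `h_τ² dω`-measure comparable
to `r ^ d ∏ i, (|x_i| + r) ^ (2 τ_i)`, so every `h_τ² dω` with `τ_i > -1/2` is doubling, and
`h_τ² / h_κ²` is a Muckenhoupt `A_r` weight relative to `h_κ² dω` as soon as
`-1/2 < τ_i < r κ_i + (r - 1) / 2`.

The kernel `V_κ[χ_{B(x,θ)}]` vanishes outside the folded ball of radius `2 θ` around `x`, is
`O(∏ i, (θ / (|x_i| + θ)) ^ (2 κ_i))` everywhere, and is bounded below by a multiple of this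
product on the part of a ball of radius comparable to `θ` that lies in the octant of `x`. Hence
`𝓜_κ` is dominated pointwise by the Hardy–Littlewood maximal function `M` of `h_κ² dω` on the
folded sphere.

The condition on `τ` is open in `p`, so `A_r` holds for some `r < p`; then `M f` is at most a
multiple of `(M_τ f ^ r) ^ (1 / r)`, where `M_τ` is the maximal function of `h_τ² dω`, and `M` is
bounded on `L^p(h_τ² dω)` without a reverse Hölder inequality. The Fefferman–Stein inequality
`∫ (M f) ^ q v ≤ C ∫ f ^ q M v`, dualized over `v`, gives the bound in `L^p(ℓ^q)` for `q > 1` close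
to `1`, and larger exponents follow by interpolating with the scalar bound at `q = ∞`.
-/

noncomputable section

open Set Metric

section LayerCake

variable {α : Type*} [MeasurableSpace α] {μ : Measure α}

lemma lintegral_Ioi_rpow_eq_top (s : ℝ) : ∫⁻ t in Ioi (0 : ℝ), ENNReal.ofReal (t ^ s) = ∞ := by
  have hpos : 0 ≤ᵐ[volume.restrict (Ioi (0 : ℝ))] fun t => t ^ s := by
    filter_upwards [ae_restrict_mem measurableSet_Ioi] with t ht
    exact Real.rpow_nonneg (mem_Ioi.1 ht).le s
  by_contra h
  refine not_integrableOn_Ioi_rpow s ⟨(by fun_prop : Measurable _).aestronglyMeasurable, ?_⟩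
  rwa [hasFiniteIntegral_iff_ofReal hpos, lt_top_iff_ne_top]

lemma lintegral_rpow_eq_lintegral_meas_ofReal_lt_mul {f : α → ℝ≥0∞} (hf : Measurable f) {p : ℝ}
    (hp : 0 < p) :
    ∫⁻ x, f x ^ p ∂μ = ENNReal.ofReal p *
      ∫⁻ t in Ioi 0, μ {x | ENNReal.ofReal t < f x} * ENNReal.ofReal (t ^ (p - 1)) := by
  by_cases htop : μ {x | f x = ∞} = 0
  · have hfin : ∀ᵐ x ∂μ, f x ≠ ∞ := measure_eq_zero_iff_ae_notMem.1 htop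
    have hleft : ∫⁻ x, f x ^ p ∂μ = ∫⁻ x, ENNReal.ofReal ((f x).toReal ^ p) ∂μ := by
      refine lintegral_congr_ae (hfin.mono fun x hx => ?_)
      dsimp only
      rw [← ENNReal.ofReal_rpow_of_nonneg ENNReal.toReal_nonneg hp.le, ENNReal.ofReal_toReal hx]
    rw [hleft, lintegral_rpow_eq_lintegral_meas_lt_mul μ (.of_forall fun _ => ENNReal.toReal_nonneg)
      hf.ennreal_toReal.aemeasurable hp]
    congr 1
    refine setLIntegral_congr_fun measurableSet_Ioi fun t ht => ?_
    congr 1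
    refine measure_congr (hfin.mono fun x hx => propext ?_)
    exact (ENNReal.ofReal_lt_iff_lt_toReal (mem_Ioi.1 ht).le hx).symm
  · have hleft : ∫⁻ x, f x ^ p ∂μ = ∞ := by
      refine lintegral_eq_top_of_measure_eq_top_ne_zero (hf.pow_const p).aemeasurable ?_
      simpa only [ENNReal.rpow_eq_top_iff_of_pos hp] using htop
    have hright : ∫⁻ t in Ioi 0, μ {x | ENNReal.ofReal t < f x} * ENNReal.ofReal (t ^ (p - 1))
        = ∞ := by
      refine top_unique ?_
      calc ∞ = ∫⁻ t in Ioi 0, μ {x | f x = ∞} * ENNReal.ofReal (t ^ (p - 1)) := by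
            rw [lintegral_const_mul _ (by fun_prop), lintegral_Ioi_rpow_eq_top,
              ENNReal.mul_top htop]
        _ ≤ _ := by
            gcongr with t x
            rintro hx
            exact hx ▸ ENNReal.ofReal_lt_top
    rw [hleft, hright, ENNReal.mul_top (by simpa using hp)]

lemma lintegral_withDensity_meas_lt_const_mul {f g : α → ℝ≥0∞} (hf : Measurable f)
    (hg : Measurable g) {c : ℝ≥0∞} (hc : c ≠ ∞) {q : ℝ} (hq : 1 < q) :
    ∫⁻ t in Ioi 0, (μ.withDensity fun x => f x * g x) {x | ENNReal.ofReal t < c * f x} *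
        ENNReal.ofReal (t ^ (q - 2)) =
      c ^ (q - 1) / ENNReal.ofReal (q - 1) * ∫⁻ x, f x ^ q * g x ∂μ := by
  have hq1 : 0 < q - 1 := by linarith
  have hlayer : ENNReal.ofReal (q - 1) * ∫⁻ t in Ioi 0,
      (μ.withDensity fun x => f x * g x) {x | ENNReal.ofReal t < c * f x} *
        ENNReal.ofReal (t ^ (q - 2)) = c ^ (q - 1) * ∫⁻ x, f x ^ q * g x ∂μ := by
    rw [← one_add_one_eq_two, ← sub_sub,
      ← lintegral_rpow_eq_lintegral_meas_ofReal_lt_mul (hf.const_mul c) hq1,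
      lintegral_withDensity_eq_lintegral_mul _ (by fun_prop) (by fun_prop),
      ← lintegral_const_mul' _ _ (by finiteness)]
    refine lintegral_congr fun x => ?_
    have hfq : f x ^ q = f x ^ (q - 1) * f x := by
      rw [← sub_add_cancel q 1, ENNReal.rpow_add_of_nonneg _ _ hq1.le zero_le_one,
        ENNReal.rpow_one, add_sub_cancel_right]
    rw [Pi.mul_apply, ENNReal.mul_rpow_of_nonneg _ _ hq1.le, hfq]
    ring
  rw [← ENNReal.mul_div_right_comm, ← hlayer, mul_comm,
    ENNReal.mul_div_cancel_right (by simpa using hq) ENNReal.ofReal_ne_top]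

lemma lintegral_rpow_eq_iSup_min {f : α → ℝ≥0∞} (hf : Measurable f) {p : ℝ} (hp : 0 < p) :
    ∫⁻ x, f x ^ p ∂μ = ⨆ N : ℕ, ∫⁻ x, min (f x) N ^ p ∂μ := by
  rw [← lintegral_iSup (fun N => by fun_prop)]
  · refine lintegral_congr fun x => ?_
    have h : f x = ⨆ N : ℕ, min (f x) N := by
      rw [← inf_iSup_eq, ENNReal.iSup_natCast, inf_top_eq]
    conv_lhs => rw [h]
    exact (ENNReal.orderIsoRpow p hp).map_iSup _
  · intro m n hmn x
    dsimp only
    gcongr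

end LayerCake

section MaximalFunction

variable {X : Type*} [PseudoMetricSpace X] [MeasurableSpace X] {μ : Measure X}

/-- The uncentred Hardy–Littlewood maximal function of a function with values in `[0,∞]`: the
supremum of its averages over the open balls containing the point. Balls of measure zero contribute
`0`, since the integral over them vanishes. -/
def maximalFunction (μ : Measure X) (f : X → ℝ≥0∞) (x : X) : ℝ≥0∞ :=
  ⨆ (z : X) (r : ℝ) (_ : x ∈ ball z r), (∫⁻ y in ball z r, f y ∂μ) / μ (ball z r)

lemma le_maximalFunction {f : X → ℝ≥0∞} {x z : X} {r : ℝ} (h : x ∈ ball z r) :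
    (∫⁻ y in ball z r, f y ∂μ) / μ (ball z r) ≤ maximalFunction μ f x :=
  le_iSup_of_le z <| le_iSup_of_le r <| le_iSup_of_le h le_rfl

lemma maximalFunction_le {f : X → ℝ≥0∞} {x : X} {a : ℝ≥0∞}
    (h : ∀ z r, x ∈ ball z r → (∫⁻ y in ball z r, f y ∂μ) / μ (ball z r) ≤ a) :
    maximalFunction μ f x ≤ a :=
  iSup_le fun z => iSup_le fun r => iSup_le fun hx => h z r hx

lemma lt_maximalFunction_iff {f : X → ℝ≥0∞} {x : X} {a : ℝ≥0∞} :
    a < maximalFunction μ f x ↔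
      ∃ z r, x ∈ ball z r ∧ a < (∫⁻ y in ball z r, f y ∂μ) / μ (ball z r) := by
  simp only [maximalFunction, lt_iSup_iff, exists_prop]

lemma isOpen_lt_maximalFunction (f : X → ℝ≥0∞) (a : ℝ≥0∞) :
    IsOpen {x | a < maximalFunction μ f x} := by
  refine isOpen_iff_forall_mem_open.2 fun x hx => ?_
  obtain ⟨z, r, hxr, hlt⟩ := lt_maximalFunction_iff.1 hx
  exact ⟨ball z r, fun y hy => lt_maximalFunction_iff.2 ⟨z, r, hy, hlt⟩, isOpen_ball, hxr⟩

lemma measurable_maximalFunction [OpensMeasurableSpace X] (f : X → ℝ≥0∞) :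
    Measurable (maximalFunction μ f) :=
  measurable_of_Ioi fun a => (isOpen_lt_maximalFunction f a).measurableSet

lemma maximalFunction_mono_ae {f g : X → ℝ≥0∞} (h : ∀ᵐ y ∂μ, f y ≤ g y) (x : X) :
    maximalFunction μ f x ≤ maximalFunction μ g x :=
  maximalFunction_le fun _ _ hx =>
    (ENNReal.div_le_div_right (lintegral_mono_ae (ae_restrict_of_ae h)) _).trans
      (le_maximalFunction hx)

lemma maximalFunction_const_le (a : ℝ≥0∞) (x : X) : maximalFunction μ (fun _ => a) x ≤ a := by
  refine maximalFunction_le fun z r _ => ?_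
  rw [setLIntegral_const]
  exact ENNReal.div_le_of_le_mul le_rfl

lemma maximalFunction_add_const_le {f : X → ℝ≥0∞} (hf : Measurable f) (a : ℝ≥0∞) (x : X) :
    maximalFunction μ (fun y => f y + a) x ≤ maximalFunction μ f x + a := by
  refine maximalFunction_le fun z r hx => ?_
  rw [lintegral_add_left hf, ENNReal.add_div, setLIntegral_const]
  exact add_le_add (le_maximalFunction hx) (ENNReal.div_le_of_le_mul le_rfl)

lemma div_rpow_mul_div_rpow (u v m : ℝ≥0∞) {a b : ℝ} (ha : 0 ≤ a) (hb : 0 ≤ b)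
    (hab : a + b = 1) : (u / m) ^ a * (v / m) ^ b = u ^ a * v ^ b / m := by
  have hm : (m ^ a)⁻¹ * (m ^ b)⁻¹ = m⁻¹ := by
    rw [← ENNReal.inv_rpow, ← ENNReal.inv_rpow, ← ENNReal.rpow_add_of_nonneg _ _ ha hb, hab,
      ENNReal.rpow_one]
  rw [ENNReal.div_rpow_of_nonneg _ _ ha, ENNReal.div_rpow_of_nonneg _ _ hb]
  simp only [div_eq_mul_inv]
  rw [mul_mul_mul_comm, hm]

lemma maximalFunction_le_rpow_mul_rpow {f g h : X → ℝ≥0∞} (hg : Measurable g) (hh : Measurable h)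
    {a b : ℝ} (ha : 0 ≤ a) (hb : 0 ≤ b) (hab : a + b = 1)
    (hf : ∀ᵐ y ∂μ, f y ≤ g y ^ a * h y ^ b) (x : X) :
    maximalFunction μ f x ≤ maximalFunction μ g x ^ a * maximalFunction μ h x ^ b := by
  refine maximalFunction_le fun z r hx => ?_
  calc (∫⁻ y in ball z r, f y ∂μ) / μ (ball z r)
      ≤ (∫⁻ y in ball z r, g y ∂μ) ^ a * (∫⁻ y in ball z r, h y ∂μ) ^ b / μ (ball z r) := by
        gcongr
        exact (lintegral_mono_ae (ae_restrict_of_ae hf)).trans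
          (ENNReal.lintegral_mul_norm_pow_le hg.aemeasurable hh.aemeasurable ha hb hab)
    _ = ((∫⁻ y in ball z r, g y ∂μ) / μ (ball z r)) ^ a *
        ((∫⁻ y in ball z r, h y ∂μ) / μ (ball z r)) ^ b :=
        (div_rpow_mul_div_rpow _ _ _ ha hb hab).symm
    _ ≤ maximalFunction μ g x ^ a * maximalFunction μ h x ^ b := by
        gcongr <;> exact le_maximalFunction hx

lemma exists_disjoint_balls_cover_lt_maximalFunction [SecondCountableTopology X] [BoundedSpace X]
    (μ : Measure X) (f : X → ℝ≥0∞) (t : ℝ≥0∞) :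
    ∃ u : Set (X × ℝ), u.Countable ∧ u.PairwiseDisjoint (fun b => ball b.1 b.2) ∧
      (∀ b ∈ u, 0 < b.2 ∧ t < (∫⁻ y in ball b.1 b.2, f y ∂μ) / μ (ball b.1 b.2)) ∧
      {x | t < maximalFunction μ f x} ⊆ ⋃ b ∈ u, ball b.1 (4 * b.2) := by
  obtain ⟨R, hR⟩ := Metric.isBounded_iff.1 (BoundedSpace.bounded_univ (α := X))
  replace hR : ∀ x y : X, dist x y ≤ R := fun x y => hR (mem_univ x) (mem_univ y)
  have hball (z : X) (r : ℝ) : ball z (min r (R + 1)) = ball z r :=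
    Subset.antisymm (ball_subset_ball (min_le_left _ _)) fun y hy =>
      lt_min hy ((hR y z).trans_lt (by linarith))
  let S : Set (X × ℝ) := {a | 0 < a.2 ∧ a.2 ≤ R + 1 ∧
    t < (∫⁻ y in ball a.1 a.2, f y ∂μ) / μ (ball a.1 a.2)}
  obtain ⟨u, huS, hdisj, hcov⟩ := Vitali.exists_disjoint_subfamily_covering_enlargement_ball
    S Prod.fst Prod.snd (R + 1) (fun a ha => ha.2.1) 4 (by norm_num)
  refine ⟨u, hdisj.countable_of_isOpen (fun a _ => isOpen_ball)
    (fun a ha => ⟨a.1, mem_ball_self (huS ha).1⟩), hdisj,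
    fun b hb => ⟨(huS hb).1, (huS hb).2.2⟩, fun x hx => ?_⟩
  obtain ⟨z, r, hxr, hlt⟩ := lt_maximalFunction_iff.1 hx
  have hmem : (z, min r (R + 1)) ∈ S := by
    refine ⟨lt_min (pos_of_mem_ball hxr) ?_, min_le_right _ _, by simpa only [hball] using hlt⟩
    linarith [dist_nonneg.trans (hR z z)]
  obtain ⟨b, hb, hsub⟩ := hcov _ hmem
  exact mem_iUnion₂.2 ⟨b, hb, hsub (by simpa only [hball] using hxr)⟩

end MaximalFunction

/-- Balls of positive radius have positive finite measure, and doubling the radius increases the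
measure at most by the factor `D`. -/
structure HasDoublingBalls {X : Type*} [PseudoMetricSpace X] [MeasurableSpace X] (μ : Measure X)
    (D : ℝ≥0) : Prop where
  ball_pos : ∀ (x : X) (r : ℝ), 0 < r → 0 < μ (ball x r)
  ball_lt_top : ∀ (x : X) (r : ℝ), μ (ball x r) < ∞
  doubling : ∀ (x : X) (r : ℝ), 0 < r → μ (ball x (2 * r)) ≤ D * μ (ball x r)

namespace HasDoublingBalls

variable {X : Type*} [PseudoMetricSpace X] [MeasurableSpace X] {μ : Measure X} {D : ℝ≥0}

lemma measure_ball_four_mul_le (hμ : HasDoublingBalls μ D) (x : X) {r : ℝ} (hr : 0 < r) :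
    μ (ball x (4 * r)) ≤ (D ^ 2 : ℝ≥0) * μ (ball x r) := by
  calc μ (ball x (4 * r)) = μ (ball x (2 * (2 * r))) := by ring_nf
    _ ≤ D * (D * μ (ball x r)) :=
        (hμ.doubling x (2 * r) (by positivity)).trans (by gcongr; exact hμ.doubling x r hr)
    _ = (D ^ 2 : ℝ≥0) * μ (ball x r) := by push_cast; ring

variable [OpensMeasurableSpace X]

lemma setLIntegral_ball_four_mul_le (hμ : HasDoublingBalls μ D) (f v : X → ℝ≥0∞) {t : ℝ≥0∞}
    (ht0 : t ≠ 0) (ht : t ≠ ∞) {z : X} {r : ℝ} (hr : 0 < r)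
    (hlt : t < (∫⁻ y in ball z r, f y ∂μ) / μ (ball z r)) :
    ∫⁻ x in ball z (4 * r), v x ∂μ ≤
      (D ^ 2 : ℝ≥0) / t * ∫⁻ x in ball z r, f x * maximalFunction μ v x ∂μ := by
  set A := (∫⁻ x in ball z (4 * r), v x ∂μ) / μ (ball z (4 * r))
  have hsmall : μ (ball z r) ≤ (∫⁻ y in ball z r, f y ∂μ) / t := by
    rw [ENNReal.le_div_iff_mul_le (.inl ht0) (.inl ht), mul_comm]
    exact (ENNReal.le_div_iff_mul_le (.inl (hμ.ball_pos _ _ hr).ne')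
      (.inl (hμ.ball_lt_top _ _).ne)).1 hlt.le
  calc ∫⁻ x in ball z (4 * r), v x ∂μ = A * μ (ball z (4 * r)) :=
        (ENNReal.div_mul_cancel (hμ.ball_pos _ _ (by positivity)).ne'
          (hμ.ball_lt_top _ _).ne).symm
    _ ≤ A * ((D ^ 2 : ℝ≥0) * ((∫⁻ y in ball z r, f y ∂μ) / t)) := by
        gcongr
        exact (hμ.measure_ball_four_mul_le z hr).trans (by gcongr)
    _ = (D ^ 2 : ℝ≥0) / t * ((∫⁻ y in ball z r, f y ∂μ) * A) := by
        simp only [div_eq_mul_inv]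
        ring
    _ ≤ (D ^ 2 : ℝ≥0) / t * ∫⁻ x in ball z r, f x * maximalFunction μ v x ∂μ := by
        gcongr
        refine (lintegral_mul_const_le _ _).trans ?_
        refine setLIntegral_mono' measurableSet_ball fun x hx => ?_
        gcongr
        exact le_maximalFunction (ball_subset_ball (by linarith) hx)

variable [SecondCountableTopology X] [BoundedSpace X]

lemma setLIntegral_lt_maximalFunction_le (hμ : HasDoublingBalls μ D) (f v : X → ℝ≥0∞) {t : ℝ≥0∞}
    (ht0 : t ≠ 0) (ht : t ≠ ∞) :
    ∫⁻ x in {x | t < maximalFunction μ f x}, v x ∂μ ≤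
      (D ^ 2 : ℝ≥0) / t * ∫⁻ x, f x * maximalFunction μ v x ∂μ := by
  obtain ⟨u, hcount, hdisj, hu, hcov⟩ := exists_disjoint_balls_cover_lt_maximalFunction μ f t
  have : Countable u := hcount
  calc ∫⁻ x in {x | t < maximalFunction μ f x}, v x ∂μ
      ≤ ∫⁻ x in ⋃ b ∈ u, ball b.1 (4 * b.2), v x ∂μ := lintegral_mono_set hcov
    _ ≤ ∑' b : u, ∫⁻ x in ball b.1.1 (4 * b.1.2), v x ∂μ := by
        rw [biUnion_eq_iUnion]
        exact lintegral_iUnion_le _ _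
    _ ≤ ∑' b : u, (D ^ 2 : ℝ≥0) / t * ∫⁻ x in ball b.1.1 b.1.2, f x * maximalFunction μ v x ∂μ :=
        ENNReal.tsum_le_tsum fun b =>
          hμ.setLIntegral_ball_four_mul_le f v ht0 ht (hu b b.2).1 (hu b b.2).2
    _ = (D ^ 2 : ℝ≥0) / t * ∫⁻ x in ⋃ b ∈ u, ball b.1 b.2, f x * maximalFunction μ v x ∂μ := by
        rw [ENNReal.tsum_mul_left, lintegral_biUnion hcount (fun _ _ => measurableSet_ball) hdisj]
    _ ≤ (D ^ 2 : ℝ≥0) / t * ∫⁻ x, f x * maximalFunction μ v x ∂μ := by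
        gcongr
        exact Measure.restrict_le_self

-- Only the part of `f` above `t / 2` can push the maximal function above `t`.
lemma setLIntegral_lt_maximalFunction_le_truncated (hμ : HasDoublingBalls μ D) {f : X → ℝ≥0∞}
    (hf : Measurable f) (v : X → ℝ≥0∞) {t : ℝ} (ht : 0 < t) :
    ∫⁻ x in {x | ENNReal.ofReal t < maximalFunction μ f x}, v x ∂μ ≤
      ENNReal.ofReal t⁻¹ * (2 * (D ^ 2 : ℝ≥0)) *
        ∫⁻ x in {x | ENNReal.ofReal t < 2 * f x}, f x * maximalFunction μ v x ∂μ := by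
  set T := ENNReal.ofReal (t / 2)
  have hT : ENNReal.ofReal t = T + T := by
    rw [← ENNReal.ofReal_add (by positivity) (by positivity), add_halves]
  set s := {x | ENNReal.ofReal t < 2 * f x}
  have hs : MeasurableSet s := measurableSet_lt measurable_const (hf.const_mul _)
  have hle : ∀ x, f x ≤ s.indicator f x + T := by
    intro x
    by_cases hx : x ∈ s
    · rw [indicator_of_mem hx]
      exact le_self_add
    · refine le_add_left ?_
      rw [mem_ofPred_eq, not_lt, hT, ← two_mul] at hx
      exact (ENNReal.mul_le_mul_iff_right (by simp) (by simp)).1 hx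
  have hsub : {x | ENNReal.ofReal t < maximalFunction μ f x} ⊆
      {x | T < maximalFunction μ (s.indicator f) x} := by
    intro x hx
    refine lt_of_add_lt_add_right (a := T) (hT ▸ lt_of_lt_of_le hx ?_)
    exact (maximalFunction_mono_ae (.of_forall hle) x).trans
      (maximalFunction_add_const_le (hf.indicator hs) T x)
  have hconst : ((D ^ 2 : ℝ≥0) : ℝ≥0∞) / T = ENNReal.ofReal t⁻¹ * (2 * (D ^ 2 : ℝ≥0)) := by
    rw [show T = _ from ENNReal.ofReal_div_of_pos two_pos, ENNReal.ofReal_inv_of_pos ht,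
      div_eq_mul_inv, ENNReal.inv_div (by simp) (by simp)]
    simp only [div_eq_mul_inv, ENNReal.ofReal_ofNat]
    ring
  refine (lintegral_mono_set hsub).trans
    ((hμ.setLIntegral_lt_maximalFunction_le _ v (by simpa [T] using ht) (by simp [T])).trans ?_)
  rw [hconst, ← lintegral_indicator hs]
  gcongr with x
  by_cases hx : x ∈ s <;> simp [hx]

lemma withDensity_lt_maximalFunction_mul_rpow_le (hμ : HasDoublingBalls μ D) {f : X → ℝ≥0∞}
    (hf : Measurable f) (v : X → ℝ≥0∞) (q : ℝ) {t : ℝ} (ht : 0 < t) :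
    μ.withDensity v {x | ENNReal.ofReal t < maximalFunction μ f x} * ENNReal.ofReal (t ^ (q - 1)) ≤
      2 * (D ^ 2 : ℝ≥0) *
        ((μ.withDensity fun x => f x * maximalFunction μ v x) {x | ENNReal.ofReal t < 2 * f x} *
          ENNReal.ofReal (t ^ (q - 2))) := by
  have hpow : ENNReal.ofReal (t ^ (q - 2)) = ENNReal.ofReal t⁻¹ * ENNReal.ofReal (t ^ (q - 1)) := by
    rw [← ENNReal.ofReal_mul (inv_nonneg.2 ht.le), ← div_eq_inv_mul, ← Real.rpow_sub_one ht.ne',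
      sub_sub, one_add_one_eq_two]
  rw [withDensity_apply _ (measurableSet_lt measurable_const (measurable_maximalFunction f)),
    withDensity_apply _ (measurableSet_lt measurable_const (hf.const_mul 2)), hpow]
  calc _ ≤ ENNReal.ofReal t⁻¹ * (2 * (D ^ 2 : ℝ≥0)) *
        (∫⁻ x in {x | ENNReal.ofReal t < 2 * f x}, f x * maximalFunction μ v x ∂μ) *
          ENNReal.ofReal (t ^ (q - 1)) := by
        gcongr
        exact hμ.setLIntegral_lt_maximalFunction_le_truncated hf v ht
    _ = _ := by ring

theorem fefferman_stein (hμ : HasDoublingBalls μ D) {q : ℝ} (hq : 1 < q) :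
    ∃ C : ℝ≥0, ∀ f v : X → ℝ≥0∞, Measurable f → Measurable v →
      ∫⁻ x, maximalFunction μ f x ^ q * v x ∂μ ≤
        C * ∫⁻ x, f x ^ q * maximalFunction μ v x ∂μ := by
  refine ⟨q.toNNReal * (2 * D ^ 2) * (2 ^ (q - 1) / (q - 1).toNNReal), fun f v hf hv => ?_⟩
  have hMf := measurable_maximalFunction (μ := μ) f
  set ν := μ.withDensity fun x => f x * maximalFunction μ v x with hν
  calc ∫⁻ x, maximalFunction μ f x ^ q * v x ∂μ
      = ∫⁻ x, maximalFunction μ f x ^ q ∂(μ.withDensity v) := by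
        rw [lintegral_withDensity_eq_lintegral_mul _ hv (hMf.pow_const q)]
        simp only [Pi.mul_apply, mul_comm]
    _ ≤ ENNReal.ofReal q * ∫⁻ t in Ioi (0 : ℝ), (2 * (D ^ 2 : ℝ≥0)) *
          (ν {x | ENNReal.ofReal t < 2 * f x} * ENNReal.ofReal (t ^ (q - 2))) := by
        rw [lintegral_rpow_eq_lintegral_meas_ofReal_lt_mul hMf (by linarith)]
        gcongr ENNReal.ofReal q * ?_
        exact setLIntegral_mono' measurableSet_Ioi fun t ht =>
          hμ.withDensity_lt_maximalFunction_mul_rpow_le hf v q ht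
    _ = _ := by
        rw [lintegral_const_mul' _ _ (by finiteness), hν,
          lintegral_withDensity_meas_lt_const_mul hf (measurable_maximalFunction v)
            (by finiteness) hq, ENNReal.coe_mul, ENNReal.coe_div (by simpa using hq),
          ENNReal.coe_rpow_of_nonneg _ (by linarith)]
        simp only [ENNReal.coe_mul, ENNReal.ofReal, ENNReal.coe_ofNat, ENNReal.coe_pow]
        ring

end HasDoublingBalls

section SequenceNorm

variable {ι : Type*}

/-- The `ℓ^q` norm of a family in `[0,∞]`, with values in `[0,∞]`. -/
def lqNorm (q : ℝ) (u : ι → ℝ≥0∞) : ℝ≥0∞ :=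
  (∑' j, u j ^ q) ^ (1 / q)

lemma lqNorm_rpow (q p : ℝ) (u : ι → ℝ≥0∞) : lqNorm q u ^ p = (∑' j, u j ^ q) ^ (p / q) := by
  rw [lqNorm, ← ENNReal.rpow_mul, one_div_mul_eq_div]

lemma lqNorm_rpow_self {q : ℝ} (hq : q ≠ 0) (u : ι → ℝ≥0∞) : lqNorm q u ^ q = ∑' j, u j ^ q := by
  rw [lqNorm_rpow, div_self hq, ENNReal.rpow_one]

lemma le_lqNorm {q : ℝ} (hq : 0 < q) (u : ι → ℝ≥0∞) (j : ι) : u j ≤ lqNorm q u := by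
  rw [← ENNReal.rpow_le_rpow_iff hq, lqNorm_rpow_self hq.ne']
  exact ENNReal.le_tsum j

lemma lqNorm_mono {q : ℝ} (hq : 0 ≤ q) {u v : ι → ℝ≥0∞} (h : ∀ j, u j ≤ v j) :
    lqNorm q u ≤ lqNorm q v := by
  unfold lqNorm
  gcongr with j
  exact h j

lemma lqNorm_const_mul {q : ℝ} (hq : 0 < q) (a : ℝ≥0∞) (u : ι → ℝ≥0∞) :
    lqNorm q (fun j => a * u j) = a * lqNorm q u := by
  simp only [lqNorm, ENNReal.mul_rpow_of_nonneg _ _ hq.le, ENNReal.tsum_mul_left]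
  rw [ENNReal.mul_rpow_of_nonneg _ _ (by positivity), one_div, ENNReal.rpow_rpow_inv hq.ne']

lemma measurable_lqNorm {α : Type*} [MeasurableSpace α] [Countable ι] (q : ℝ)
    {f : ι → α → ℝ≥0∞} (hf : ∀ j, Measurable (f j)) : Measurable fun x => lqNorm q (f · x) :=
  (Measurable.tsum fun j => (hf j).pow_const q).pow_const _

lemma lqNorm_le_rpow_mul_rpow {q Q : ℝ} (hq : 0 < q) (hqQ : q < Q) {u v : ι → ℝ≥0∞} {K : ℝ≥0∞}
    (h : ∀ j, u j ≤ v j ^ (q / Q) * K ^ (1 - q / Q)) :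
    lqNorm Q u ≤ lqNorm q v ^ (q / Q) * K ^ (1 - q / Q) := by
  have hQ : 0 < Q := hq.trans hqQ
  rw [← ENNReal.rpow_le_rpow_iff hQ, lqNorm_rpow_self hQ.ne', ENNReal.mul_rpow_of_nonneg _ _ hQ.le,
    ← ENNReal.rpow_mul, div_mul_cancel₀ _ hQ.ne', lqNorm_rpow_self hq.ne',
    ← ENNReal.tsum_mul_right]
  gcongr with j
  calc u j ^ Q ≤ (v j ^ (q / Q) * K ^ (1 - q / Q)) ^ Q := by gcongr; exact h j
    _ = v j ^ q * (K ^ (1 - q / Q)) ^ Q := by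
        rw [ENNReal.mul_rpow_of_nonneg _ _ hQ.le, ← ENNReal.rpow_mul, div_mul_cancel₀ _ hQ.ne']

/-- The family `u` raised to the power `Q / q` and rescaled so that its `ℓ^q` norm is at most the
`ℓ^Q` norm of `u`. -/
def lqRescale (q Q : ℝ) (u : ι → ℝ≥0∞) (j : ι) : ℝ≥0∞ :=
  u j ^ (Q / q) * lqNorm Q u ^ (1 - Q / q)

lemma le_lqRescale_rpow_mul_rpow {q Q : ℝ} (hq : 0 < q) (hqQ : q < Q) {u : ι → ℝ≥0∞}
    (hu : lqNorm Q u ≠ ∞) (j : ι) :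
    u j ≤ lqRescale q Q u j ^ (q / Q) * lqNorm Q u ^ (1 - q / Q) := by
  have hQ : 0 < Q := hq.trans hqQ
  rcases eq_or_ne (lqNorm Q u) 0 with h0 | h0
  · exact (le_lqNorm hQ u j).trans (h0 ▸ zero_le)
  · have hexp : (1 - Q / q) * (q / Q) + (1 - q / Q) = 0 := by field_simp; ring
    rw [lqRescale, ENNReal.mul_rpow_of_nonneg _ _ (by positivity), ← ENNReal.rpow_mul,
      ← ENNReal.rpow_mul, div_mul_div_cancel₀ hq.ne', div_self hQ.ne', ENNReal.rpow_one, mul_assoc,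
      ← ENNReal.rpow_add _ _ h0 hu, hexp, ENNReal.rpow_zero, mul_one]

lemma lqNorm_lqRescale_le {q Q : ℝ} (hq : 0 < q) (hqQ : q < Q) (u : ι → ℝ≥0∞) :
    lqNorm q (lqRescale q Q u) ≤ lqNorm Q u := by
  have hQ : 0 < Q := hq.trans hqQ
  have hterm (j : ι) : lqRescale q Q u j ^ q = u j ^ Q * lqNorm Q u ^ (q - Q) := by
    rw [lqRescale, ENNReal.mul_rpow_of_nonneg _ _ hq.le, ← ENNReal.rpow_mul, ← ENNReal.rpow_mul,
      sub_mul, div_mul_cancel₀ _ hq.ne', one_mul]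
  rw [← ENNReal.rpow_le_rpow_iff hq, lqNorm_rpow_self hq.ne']
  simp only [hterm]
  rw [ENNReal.tsum_mul_right, ← lqNorm_rpow_self hQ.ne']
  rcases eq_or_ne (lqNorm Q u) 0 with h0 | h0
  · simp [h0, ENNReal.zero_rpow_of_pos hQ]
  rcases eq_or_ne (lqNorm Q u) ∞ with ht | ht
  · simp [ht, ENNReal.top_rpow_of_pos hq]
  · rw [← ENNReal.rpow_add _ _ h0 ht, add_sub_cancel]

end SequenceNorm

section WeightedDuality

variable {α : Type*} [MeasurableSpace α] {μ : Measure α} {w : α → ℝ≥0∞} {p s : ℝ}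

lemma le_rpow_of_le_mul_rpow_one_div {a b : ℝ≥0∞} (hps : p.HolderConjugate s)
    (ha : a ≠ ∞) (h : a ≤ b * a ^ (1 / s)) : a ≤ b ^ p := by
  rcases eq_or_ne a 0 with rfl | ha0
  · exact zero_le
  have hsplit : a ^ (1 / p) * a ^ (1 / s) = a := by
    rw [← ENNReal.rpow_add _ _ ha0 ha, one_div, one_div, hps.inv_add_inv_eq_one, ENNReal.rpow_one]
  have hroot : a ^ (1 / p) ≤ b :=
    (ENNReal.mul_le_mul_iff_left (by simp [ENNReal.rpow_eq_zero_iff, ha0, ha])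
      (ENNReal.rpow_ne_top_of_ne_zero ha0 ha)).1 (hsplit.trans_le h)
  calc a = (a ^ (1 / p)) ^ p := by rw [one_div, ENNReal.rpow_inv_rpow hps.pos.ne']
    _ ≤ b ^ p := ENNReal.rpow_le_rpow hroot hps.pos.le

lemma lintegral_mul_le_withDensity_mul_withDensity_dual (hw : Measurable w)
    (hw0 : ∀ᵐ x ∂μ, w x ≠ 0 ∧ w x ≠ ∞) (hps : p.HolderConjugate s) {f g : α → ℝ≥0∞}
    (hf : Measurable f) (hg : Measurable g) :
    ∫⁻ x, f x * g x ∂μ ≤ (∫⁻ x, f x ^ p ∂(μ.withDensity w)) ^ (1 / p) *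
      (∫⁻ x, g x ^ s ∂(μ.withDensity fun x => w x ^ (1 - s))) ^ (1 / s) := by
  have hexp : -(1 / p) * s = 1 - s := by
    have := hps.sub_one_mul_conj
    have := hps.ne_zero
    field_simp
    linarith
  calc ∫⁻ x, f x * g x ∂μ
      = ∫⁻ x, (f x * w x ^ (1 / p)) * (g x * w x ^ (-(1 / p))) ∂μ := by
        refine lintegral_congr_ae (hw0.mono fun x hx => ?_)
        dsimp only
        rw [mul_mul_mul_comm, ← ENNReal.rpow_add _ _ hx.1 hx.2, add_neg_cancel, ENNReal.rpow_zero,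
          mul_one]
    _ ≤ (∫⁻ x, (f x * w x ^ (1 / p)) ^ p ∂μ) ^ (1 / p) *
        (∫⁻ x, (g x * w x ^ (-(1 / p))) ^ s ∂μ) ^ (1 / s) :=
        ENNReal.lintegral_mul_le_Lp_mul_Lq μ hps (by fun_prop) (by fun_prop)
    _ = _ := by
        simp only [ENNReal.mul_rpow_of_nonneg _ _ hps.nonneg,
          ENNReal.mul_rpow_of_nonneg _ _ hps.symm.nonneg, ← ENNReal.rpow_mul, hexp,
          one_div_mul_cancel hps.ne_zero, ENNReal.rpow_one]
        rw [lintegral_withDensity_eq_lintegral_mul _ hw (by fun_prop),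
          lintegral_withDensity_eq_lintegral_mul _ (by fun_prop) (by fun_prop)]
        simp only [Pi.mul_apply, mul_comm]

lemma lintegral_rpow_sub_one_mul_rpow_withDensity_dual (hw : Measurable w)
    (hw0 : ∀ᵐ x ∂μ, w x ≠ 0 ∧ w x ≠ ∞) (hps : p.HolderConjugate s) {g : α → ℝ≥0∞}
    (hg : Measurable g) :
    ∫⁻ x, (g x ^ (p - 1) * w x) ^ s ∂(μ.withDensity fun x => w x ^ (1 - s)) =
      ∫⁻ x, g x ^ p ∂(μ.withDensity w) := by
  rw [lintegral_withDensity_eq_lintegral_mul _ hw (by fun_prop),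
    lintegral_withDensity_eq_lintegral_mul _ (by fun_prop) (by fun_prop)]
  refine lintegral_congr_ae (hw0.mono fun x hx => ?_)
  simp only [Pi.mul_apply]
  rw [ENNReal.mul_rpow_of_nonneg _ _ hps.symm.nonneg, ← ENNReal.rpow_mul, hps.sub_one_mul_conj,
    mul_left_comm, ← ENNReal.rpow_add _ _ hx.1 hx.2, sub_add_cancel, ENNReal.rpow_one, mul_comm]

section DualOperator

variable {T : (α → ℝ≥0∞) → α → ℝ≥0∞} {A C : ℝ≥0} {g h : α → ℝ≥0∞}

-- Test the hypothesis on `v = g ^ (p - 1) * w` and absorb `∫ g ^ p` into the left-hand side.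
lemma lintegral_rpow_withDensity_le_of_dual_of_ne_top (hw : Measurable w)
    (hw0 : ∀ᵐ x ∂μ, w x ≠ 0 ∧ w x ≠ ∞) (hps : p.HolderConjugate s)
    (hTm : ∀ v, Measurable (T v))
    (hT : ∀ v, Measurable v → ∫⁻ x, T v x ^ s ∂(μ.withDensity fun x => w x ^ (1 - s)) ≤
      A * ∫⁻ x, v x ^ s ∂(μ.withDensity fun x => w x ^ (1 - s)))
    (hg : Measurable g) (hh : Measurable h)
    (hgh : ∀ v, Measurable v → ∫⁻ x, g x * v x ∂μ ≤ C * ∫⁻ x, h x * T v x ∂μ)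
    (hfin : ∫⁻ x, g x ^ p ∂(μ.withDensity w) ≠ ∞) :
    ∫⁻ x, g x ^ p ∂(μ.withDensity w) ≤
      ((C * A ^ (1 / s)) ^ p : ℝ≥0) * ∫⁻ x, h x ^ p ∂(μ.withDensity w) := by
  set I := ∫⁻ x, g x ^ p ∂(μ.withDensity w) with hI
  set J := ∫⁻ x, h x ^ p ∂(μ.withDensity w)
  set v : α → ℝ≥0∞ := fun x => g x ^ (p - 1) * w x
  have hv : Measurable v := by fun_prop
  have hgp (x : α) : g x ^ p = g x * g x ^ (p - 1) := by
    conv_lhs => rw [← add_sub_cancel 1 p, ENNReal.rpow_add_of_nonneg _ _ zero_le_one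
      hps.sub_one_pos.le, ENNReal.rpow_one]
  have habsorb : I ≤ C * (A ^ (1 / s) : ℝ≥0) * J ^ (1 / p) * I ^ (1 / s) :=
    calc I = ∫⁻ x, g x * v x ∂μ := by
          rw [hI, lintegral_withDensity_eq_lintegral_mul _ hw (by fun_prop)]
          refine lintegral_congr fun x => ?_
          rw [Pi.mul_apply, hgp, mul_comm, mul_assoc]
      _ ≤ C * ∫⁻ x, h x * T v x ∂μ := hgh v hv
      _ ≤ C * (J ^ (1 / p) * (A * I) ^ (1 / s)) := by
          gcongr
          refine (lintegral_mul_le_withDensity_mul_withDensity_dual hw hw0 hps hh (hTm v)).trans ?_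
          gcongr
          · exact hps.symm.one_div_nonneg
          · exact (hT v hv).trans_eq
              (by rw [lintegral_rpow_sub_one_mul_rpow_withDensity_dual hw hw0 hps hg])
      _ = C * (A ^ (1 / s) : ℝ≥0) * J ^ (1 / p) * I ^ (1 / s) := by
          rw [ENNReal.mul_rpow_of_nonneg _ _ hps.symm.one_div_nonneg,
            ENNReal.coe_rpow_of_nonneg _ hps.symm.one_div_nonneg]
          ring
  refine (le_rpow_of_le_mul_rpow_one_div hps hfin habsorb).trans_eq ?_
  rw [ENNReal.mul_rpow_of_nonneg _ _ hps.nonneg, ← ENNReal.rpow_mul,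
    one_div_mul_cancel hps.ne_zero, ENNReal.rpow_one, ← ENNReal.coe_mul,
    ENNReal.coe_rpow_of_nonneg _ hps.nonneg]

lemma lintegral_rpow_withDensity_le_of_dual [IsFiniteMeasure (μ.withDensity w)] (hw : Measurable w)
    (hw0 : ∀ᵐ x ∂μ, w x ≠ 0 ∧ w x ≠ ∞) (hps : p.HolderConjugate s)
    (hTm : ∀ v, Measurable (T v))
    (hT : ∀ v, Measurable v → ∫⁻ x, T v x ^ s ∂(μ.withDensity fun x => w x ^ (1 - s)) ≤
      A * ∫⁻ x, v x ^ s ∂(μ.withDensity fun x => w x ^ (1 - s)))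
    (hg : Measurable g) (hh : Measurable h)
    (hgh : ∀ v, Measurable v → ∫⁻ x, g x * v x ∂μ ≤ C * ∫⁻ x, h x * T v x ∂μ) :
    ∫⁻ x, g x ^ p ∂(μ.withDensity w) ≤
      ((C * A ^ (1 / s)) ^ p : ℝ≥0) * ∫⁻ x, h x ^ p ∂(μ.withDensity w) := by
  rw [lintegral_rpow_eq_iSup_min hg hps.pos]
  refine iSup_le fun N => lintegral_rpow_withDensity_le_of_dual_of_ne_top hw hw0 hps hTm hT
    (hg.min measurable_const) hh (fun v hv => le_trans ?_ (hgh v hv)) ?_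
  · gcongr with x
    exact min_le_left _ _
  · refine ne_top_of_le_ne_top (b := ∫⁻ _, (N : ℝ≥0∞) ^ p ∂(μ.withDensity w)) ?_ ?_
    · rw [lintegral_const]
      exact ENNReal.mul_ne_top (ENNReal.rpow_ne_top_of_nonneg hps.nonneg (by simp))
        (measure_ne_top _ _)
    · gcongr with x
      · exact hps.nonneg
      · exact min_le_right _ _

end DualOperator

end WeightedDuality

section WeightedMaximal

variable {X : Type*} [PseudoMetricSpace X] [MeasurableSpace X] {μ ν : Measure X} {D : ℝ≥0}
  {w : X → ℝ≥0∞} {p q r s : ℝ}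

/-- The maximal function of `μ` is bounded on `L^p(ν)`. -/
def MaximalStrongType (μ ν : Measure X) (p : ℝ) : Prop :=
  ∃ C : ℝ≥0, ∀ f : X → ℝ≥0∞, Measurable f →
    ∫⁻ x, maximalFunction μ f x ^ p ∂ν ≤ C * ∫⁻ x, f x ^ p ∂ν

/-- The maximal function of `μ`, applied to each member of a family indexed by `ι`, is bounded on
`L^p(ν; ℓ^q(ι))`. -/
def MaximalVectorStrongType (ι : Type*) (μ ν : Measure X) (p q : ℝ) : Prop :=
  ∃ C : ℝ≥0, ∀ f : ι → X → ℝ≥0∞, (∀ j, Measurable (f j)) →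
    ∫⁻ x, lqNorm q (fun j => maximalFunction μ (f j) x) ^ p ∂ν ≤
      C * ∫⁻ x, lqNorm q (f · x) ^ p ∂ν

/-- The Muckenhoupt condition `A_r` for a weight `w` relative to `μ`, over all balls. -/
def IsMuckenhoupt (μ : Measure X) (w : X → ℝ≥0∞) (r : ℝ) : Prop :=
  ∃ K : ℝ≥0, ∀ (z : X) (ρ : ℝ), 0 < ρ →
    μ.withDensity w (ball z ρ) ^ (1 / r) *
        (μ.withDensity fun x => w x ^ (1 - r.conjExponent)) (ball z ρ) ^ (1 / r.conjExponent) ≤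
      K * μ (ball z ρ)

variable [OpensMeasurableSpace X]

lemma IsMuckenhoupt.exists_maximalFunction_le_rpow (hμw : IsMuckenhoupt μ w r) (hr : 1 < r)
    (hwμ : HasDoublingBalls (μ.withDensity w) D) (hw : Measurable w)
    (hw0 : ∀ᵐ x ∂μ, w x ≠ 0 ∧ w x ≠ ∞) :
    ∃ K : ℝ≥0, ∀ g : X → ℝ≥0∞, Measurable g → ∀ x, maximalFunction μ g x ≤
      K * maximalFunction (μ.withDensity w) (fun y => g y ^ r) x ^ (1 / r) := by
  obtain ⟨K, hK⟩ := hμw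
  have hrr' : r.HolderConjugate r.conjExponent := .conjExponent hr
  refine ⟨K, fun g hg x => maximalFunction_le fun z ρ hx => ?_⟩
  have hρ : 0 < ρ := pos_of_mem_ball hx
  set B := ball z ρ
  set I := ∫⁻ y in B, g y ^ r ∂(μ.withDensity w)
  set W := μ.withDensity w B ^ (1 / r) with hW
  set S := (μ.withDensity fun x => w x ^ (1 - r.conjExponent)) B ^ (1 / r.conjExponent)
  have hW0 : W ≠ 0 := by
    simp [hW, ENNReal.rpow_eq_zero_iff, (hwμ.ball_pos z ρ hρ).ne', (hwμ.ball_lt_top z ρ).ne, B]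
  have hWtop : W ≠ ∞ := ENNReal.rpow_ne_top_of_nonneg hrr'.one_div_nonneg (hwμ.ball_lt_top z ρ).ne
  have hHolder : ∫⁻ y in B, g y ∂μ ≤ I ^ (1 / r) * S := by
    have h := lintegral_mul_le_withDensity_mul_withDensity_dual (μ := μ.restrict B) hw
      (ae_restrict_of_ae hw0) hrr' hg (measurable_const (a := 1))
    simpa only [mul_one, ENNReal.one_rpow, ← restrict_withDensity measurableSet_ball, B,
      lintegral_one, Measure.restrict_apply_univ] using h
  calc (∫⁻ y in B, g y ∂μ) / μ B ≤ K * (I ^ (1 / r) / W) := by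
        refine ENNReal.div_le_of_le_mul ?_
        rw [← mul_div_assoc, ← ENNReal.mul_div_right_comm,
          ENNReal.le_div_iff_mul_le (.inl hW0) (.inl hWtop)]
        calc (∫⁻ y in B, g y ∂μ) * W ≤ I ^ (1 / r) * S * W := by gcongr
          _ = I ^ (1 / r) * (W * S) := by ring
          _ ≤ I ^ (1 / r) * (K * μ B) := by gcongr I ^ (1 / r) * ?_; exact hK z ρ hρ
          _ = K * I ^ (1 / r) * μ B := by ring
    _ = K * (I / μ.withDensity w B) ^ (1 / r) := by
        rw [ENNReal.div_rpow_of_nonneg _ _ hrr'.one_div_nonneg]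
    _ ≤ K * maximalFunction (μ.withDensity w) (fun y => g y ^ r) x ^ (1 / r) := by
        gcongr
        exact le_maximalFunction hx

variable [SecondCountableTopology X] [BoundedSpace X]

lemma HasDoublingBalls.maximalStrongType_self (hμ : HasDoublingBalls μ D) (hp : 1 < p) :
    MaximalStrongType μ μ p := by
  obtain ⟨C, hC⟩ := hμ.fefferman_stein hp
  refine ⟨C, fun f hf => ?_⟩
  calc ∫⁻ x, maximalFunction μ f x ^ p ∂μ = ∫⁻ x, maximalFunction μ f x ^ p * 1 ∂μ := by
        simp only [mul_one]
    _ ≤ C * ∫⁻ x, f x ^ p * maximalFunction μ (fun _ => 1) x ∂μ :=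
        hC f (fun _ => 1) hf measurable_const
    _ ≤ C * ∫⁻ x, f x ^ p ∂μ := by
        gcongr with x
        exact mul_le_of_le_one_right' (maximalFunction_const_le 1 x)

lemma IsMuckenhoupt.maximalStrongType (hμw : IsMuckenhoupt μ w r) (hr : 1 < r) (hrs : r < s)
    (hwμ : HasDoublingBalls (μ.withDensity w) D) (hw : Measurable w)
    (hw0 : ∀ᵐ x ∂μ, w x ≠ 0 ∧ w x ≠ ∞) :
    MaximalStrongType μ (μ.withDensity w) s := by
  have hr0 : 0 < r := by linarith
  have hs0 : 0 < s := by linarith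
  obtain ⟨K, hK⟩ := hμw.exists_maximalFunction_le_rpow hr hwμ hw hw0
  obtain ⟨C, hC⟩ := hwμ.maximalStrongType_self ((one_lt_div hr0).2 hrs)
  refine ⟨K ^ s * C, fun g hg => ?_⟩
  calc ∫⁻ x, maximalFunction μ g x ^ s ∂(μ.withDensity w)
      ≤ ∫⁻ x, (K : ℝ≥0∞) ^ s * maximalFunction (μ.withDensity w) (fun y => g y ^ r) x ^ (s / r)
          ∂(μ.withDensity w) := by
        refine lintegral_mono fun x => (ENNReal.rpow_le_rpow (hK g hg x) hs0.le).trans_eq ?_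
        rw [ENNReal.mul_rpow_of_nonneg _ _ hs0.le, ← ENNReal.rpow_mul, one_div_mul_eq_div]
    _ = (K : ℝ≥0∞) ^ s * ∫⁻ x,
          maximalFunction (μ.withDensity w) (fun y => g y ^ r) x ^ (s / r) ∂(μ.withDensity w) :=
        lintegral_const_mul' _ _ (by finiteness)
    _ ≤ (K : ℝ≥0∞) ^ s * (C * ∫⁻ x, (g x ^ r) ^ (s / r) ∂(μ.withDensity w)) := by
        gcongr
        exact hC _ (hg.pow_const r)
    _ = (K ^ s * C : ℝ≥0) * ∫⁻ x, g x ^ s ∂(μ.withDensity w) := by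
        simp only [← ENNReal.rpow_mul, mul_div_cancel₀ s hr0.ne']
        rw [ENNReal.coe_mul, ENNReal.coe_rpow_of_nonneg _ hs0.le, mul_assoc]

variable {ι : Type*} [Countable ι]

lemma HasDoublingBalls.fefferman_stein_tsum (hμ : HasDoublingBalls μ D) (hq : 1 < q) :
    ∃ C : ℝ≥0, ∀ (f : ι → X → ℝ≥0∞) (v : X → ℝ≥0∞), (∀ j, Measurable (f j)) → Measurable v →
      ∫⁻ x, (∑' j, maximalFunction μ (f j) x ^ q) * v x ∂μ ≤
        C * ∫⁻ x, (∑' j, f j x ^ q) * maximalFunction μ v x ∂μ := by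
  obtain ⟨C, hC⟩ := hμ.fefferman_stein hq
  refine ⟨C, fun f v hf hv => ?_⟩
  have hMf (j : ι) := measurable_maximalFunction (μ := μ) (f j)
  have hMv := measurable_maximalFunction (μ := μ) v
  simp only [← ENNReal.tsum_mul_right]
  rw [lintegral_tsum fun j => by fun_prop, lintegral_tsum fun j => by fun_prop,
    ← ENNReal.tsum_mul_left]
  exact ENNReal.tsum_le_tsum fun j => hC (f j) v (hf j) hv

theorem HasDoublingBalls.maximalVectorStrongType_of_dual (hμ : HasDoublingBalls μ D)
    (hw : Measurable w) (hw0 : ∀ᵐ x ∂μ, w x ≠ 0 ∧ w x ≠ ∞) [IsFiniteMeasure (μ.withDensity w)]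
    (hq : 1 < q) (hps : (p / q).HolderConjugate s)
    (hdual : MaximalStrongType μ (μ.withDensity fun x => w x ^ (1 - s)) s) :
    MaximalVectorStrongType ι μ (μ.withDensity w) p q := by
  obtain ⟨C, hC⟩ := hμ.fefferman_stein_tsum (ι := ι) hq
  obtain ⟨A, hA⟩ := hdual
  refine ⟨(C * A ^ (1 / s)) ^ (p / q), fun f hf => ?_⟩
  simp only [lqNorm_rpow]
  exact lintegral_rpow_withDensity_le_of_dual hw hw0 hps measurable_maximalFunction hA
    (.tsum fun j => (measurable_maximalFunction (f j)).pow_const q)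
    (.tsum fun j => (hf j).pow_const q) fun v hv => hC f v hf hv

end WeightedMaximal

section Interpolation

lemma lintegral_rpow_mul_rpow_le_of_le {α : Type*} [MeasurableSpace α] {ν : Measure α}
    {f g : α → ℝ≥0∞} {a b : ℝ} {K : ℝ≥0∞} (hf : AEMeasurable f ν) (hg : AEMeasurable g ν)
    (ha : 0 ≤ a) (hb : 0 ≤ b) (hab : a + b = 1) (hfK : ∫⁻ x, f x ∂ν ≤ K)
    (hgK : ∫⁻ x, g x ∂ν ≤ K) : ∫⁻ x, f x ^ a * g x ^ b ∂ν ≤ K :=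
  calc ∫⁻ x, f x ^ a * g x ^ b ∂ν ≤ (∫⁻ x, f x ∂ν) ^ a * (∫⁻ x, g x ∂ν) ^ b :=
        ENNReal.lintegral_mul_norm_pow_le hf hg ha hb hab
    _ ≤ K ^ a * K ^ b := by gcongr
    _ = K := by rw [← ENNReal.rpow_add_of_nonneg _ _ ha hb, hab, ENNReal.rpow_one]

variable {X : Type*} [PseudoMetricSpace X] [MeasurableSpace X] {μ ν : Measure X}
  {p q Q : ℝ} {ι : Type*} [Countable ι]

lemma lqNorm_maximalFunction_le_rpow_mul_rpow (hq : 0 < q) (hqQ : q < Q) {f : ι → X → ℝ≥0∞}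
    (hf : ∀ j, Measurable (f j)) (hfin : ∀ᵐ y ∂μ, lqNorm Q (f · y) ≠ ∞) (x : X) :
    lqNorm Q (fun j => maximalFunction μ (f j) x) ≤
      lqNorm q (fun j => maximalFunction μ (fun y => lqRescale q Q (f · y) j) x) ^ (q / Q) *
        maximalFunction μ (fun y => lqNorm Q (f · y)) x ^ (1 - q / Q) := by
  have hQ : 0 < Q := hq.trans hqQ
  have hF := measurable_lqNorm Q hf
  exact lqNorm_le_rpow_mul_rpow hq hqQ fun j => maximalFunction_le_rpow_mul_rpow
    (((hf j).pow_const _).mul (hF.pow_const _)) hF (by positivity)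
    (sub_nonneg.2 ((div_le_one hQ).2 hqQ.le)) (add_sub_cancel _ _)
    (hfin.mono fun y hy => le_lqRescale_rpow_mul_rpow hq hqQ hy j) x

-- The exponent `Q` lies between `q` and `∞`, and the `ℓ^∞` bound is the scalar one because
-- `⨆ j, M (f j) ≤ M (⨆ j, f j)`.
theorem MaximalVectorStrongType.of_lt [OpensMeasurableSpace X]
    (hvec : MaximalVectorStrongType ι μ ν p q)
    (hscalar : MaximalStrongType μ ν p) (hμν : μ ≪ ν) (hp : 0 < p) (hq : 0 < q) (hqQ : q < Q) :
    MaximalVectorStrongType ι μ ν p Q := by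
  obtain ⟨C, hC⟩ := hvec
  obtain ⟨A, hA⟩ := hscalar
  have hQ : 0 < Q := hq.trans hqQ
  have hb : 0 ≤ 1 - q / Q := sub_nonneg.2 ((div_le_one hQ).2 hqQ.le)
  refine ⟨C + A + 1, fun f hf => ?_⟩
  set F : X → ℝ≥0∞ := fun x => lqNorm Q (f · x)
  set J := ∫⁻ x, F x ^ p ∂ν
  have hFm : Measurable F := measurable_lqNorm Q hf
  rcases eq_or_ne J ∞ with htop | hfin
  · rw [htop, ENNReal.mul_top (by simp)]
    exact le_top
  have hFfin : ∀ᵐ x ∂μ, F x ≠ ∞ := hμν.ae_le <| by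
    filter_upwards [ae_lt_top (hFm.pow_const p) hfin] with x hx htop
    simp [htop, ENNReal.top_rpow_of_pos hp] at hx
  set g : ι → X → ℝ≥0∞ := fun j x => lqRescale q Q (f · x) j
  have hgm (j : ι) : Measurable (g j) := ((hf j).pow_const _).mul (hFm.pow_const _)
  set G : X → ℝ≥0∞ := fun x => lqNorm q (fun j => maximalFunction μ (g j) x)
  have hGm : Measurable G := measurable_lqNorm q fun j => measurable_maximalFunction (g j)
  have hG : ∫⁻ x, G x ^ p ∂ν ≤ (C + A + 1 : ℝ≥0) * J := by
    refine (hC g hgm).trans (mul_le_mul' (by push_cast; rw [add_assoc]; exact le_self_add) ?_)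
    exact lintegral_mono fun x => ENNReal.rpow_le_rpow (lqNorm_lqRescale_le hq hqQ _) hp.le
  have hMF : ∫⁻ x, maximalFunction μ F x ^ p ∂ν ≤ (C + A + 1 : ℝ≥0) * J :=
    (hA F hFm).trans (mul_le_mul' (by push_cast; exact le_self_add.trans' le_add_self) le_rfl)
  calc ∫⁻ x, lqNorm Q (fun j => maximalFunction μ (f j) x) ^ p ∂ν
      ≤ ∫⁻ x, (G x ^ p) ^ (q / Q) * (maximalFunction μ F x ^ p) ^ (1 - q / Q) ∂ν := by
        refine lintegral_mono fun x => (ENNReal.rpow_le_rpow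
          (lqNorm_maximalFunction_le_rpow_mul_rpow hq hqQ hf hFfin x) hp.le).trans_eq ?_
        simp only [ENNReal.mul_rpow_of_nonneg _ _ hp.le, ← ENNReal.rpow_mul, mul_comm, G, g, F]
    _ ≤ (C + A + 1 : ℝ≥0) * J :=
        lintegral_rpow_mul_rpow_le_of_le (by fun_prop)
          ((measurable_maximalFunction F).pow_const p).aemeasurable (by positivity) hb
          (add_sub_cancel _ _) hG hMF

end Interpolation

section PolarCoordinates

variable {E : Type*} [NormedAddCommGroup E] [NormedSpace ℝ E] [MeasurableSpace E] [BorelSpace E]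
  [FiniteDimensional ℝ E] [Nontrivial E] (μ : Measure E) [μ.IsAddHaarMeasure]

lemma lintegral_normalize_mul_norm {g : E → ℝ≥0∞} (hg : Measurable g) {h : ℝ → ℝ≥0∞}
    (hh : Measurable h) :
    ∫⁻ z, g (‖z‖⁻¹ • z) * h ‖z‖ ∂μ = (∫⁻ y : sphere (0 : E) 1, g y ∂μ.toSphere) *
      ∫⁻ s : Ioi (0 : ℝ), h s ∂(Measure.volumeIoiPow (Module.finrank ℝ E - 1)) := by
  rw [← lintegral_prod_mul (by fun_prop) (by fun_prop),
    ← μ.measurePreserving_homeomorphUnitSphereProd.lintegral_comp_emb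
      (Homeomorph.measurableEmbedding _)]
  simp only [homeomorphUnitSphereProd_apply_snd_coe, homeomorphUnitSphereProd_apply_fst_coe]
  rw [lintegral_subtype_comap (measurableSet_singleton _).compl
    (fun z => g (‖z‖⁻¹ • z) * h ‖z‖), restrict_compl_singleton]

lemma lintegral_volumeIoiPow (n : ℕ) {h : ℝ → ℝ≥0∞} (hh : Measurable h) :
    ∫⁻ s : Ioi (0 : ℝ), h s ∂(Measure.volumeIoiPow n) =
      ∫⁻ s in Ioi 0, ENNReal.ofReal (s ^ n) * h s := by
  rw [Measure.volumeIoiPow, lintegral_withDensity_eq_lintegral_mul _ (by fun_prop) (by fun_prop)]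
  exact lintegral_subtype_comap measurableSet_Ioi fun s : ℝ => ENNReal.ofReal (s ^ n) * h s

lemma setLIntegral_normalize_shell {g : E → ℝ≥0∞} (hg : Measurable g) {a b : ℝ} (ha : 0 ≤ a) :
    ∫⁻ z in norm ⁻¹' Ioo a b, g (‖z‖⁻¹ • z) ∂μ = (∫⁻ y : sphere (0 : E) 1, g y ∂μ.toSphere) *
      ∫⁻ s in Ioo a b, ENNReal.ofReal (s ^ (Module.finrank ℝ E - 1)) := by
  classical
  have hind : Measurable ((Ioo a b).indicator (1 : ℝ → ℝ≥0∞)) :=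
    measurable_one.indicator measurableSet_Ioo
  have hshell : ∀ z, (norm ⁻¹' Ioo a b).indicator (fun z => g (‖z‖⁻¹ • z)) z =
      g (‖z‖⁻¹ • z) * (Ioo a b).indicator 1 ‖z‖ := fun z => by
    simp only [indicator_apply, mem_preimage, Pi.one_apply, mul_ite, mul_one, mul_zero]
  have hradial : ∀ s, (Ioo a b).indicator (fun s => ENNReal.ofReal (s ^ (Module.finrank ℝ E - 1))) s
      = ENNReal.ofReal (s ^ (Module.finrank ℝ E - 1)) * (Ioo a b).indicator 1 s := fun s => by
    simp only [indicator_apply, Pi.one_apply, mul_ite, mul_one, mul_zero]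
  have hpos : Ioo a b ∩ Ioi 0 = Ioo a b :=
    inter_eq_left.2 (Ioo_subset_Ioi_self.trans (Ioi_subset_Ioi ha))
  rw [← lintegral_indicator (measurableSet_Ioo.preimage measurable_norm)]
  simp only [hshell]
  rw [lintegral_normalize_mul_norm μ hg hind, lintegral_volumeIoiPow _ hind]
  simp only [← hradial]
  rw [lintegral_indicator measurableSet_Ioo, Measure.restrict_restrict measurableSet_Ioo, hpos]

end PolarCoordinates

lemma le_lintegral_pow_shell (n : ℕ) (r : ℝ) :
    ENNReal.ofReal r ≤ ∫⁻ s in Ioo 1 (1 + r), ENNReal.ofReal (s ^ n) := by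
  calc ENNReal.ofReal r = ∫⁻ _ in Ioo 1 (1 + r), 1 := by simp
    _ ≤ _ := by
      refine setLIntegral_mono' measurableSet_Ioo fun s hs => ?_
      rw [← ENNReal.ofReal_one]
      exact ENNReal.ofReal_le_ofReal (one_le_pow₀ hs.1.le)

lemma lintegral_pow_shell_le (n : ℕ) {r R : ℝ} (hr : r ≤ R) :
    ∫⁻ s in Ioo 1 (1 + r), ENNReal.ofReal (s ^ n) ≤
      ENNReal.ofReal ((1 + R) ^ n) * ENNReal.ofReal r := by
  calc ∫⁻ s in Ioo 1 (1 + r), ENNReal.ofReal (s ^ n)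
      ≤ ∫⁻ _ in Ioo 1 (1 + r), ENNReal.ofReal ((1 + R) ^ n) := by
        refine setLIntegral_mono' measurableSet_Ioo fun s hs => ?_
        refine ENNReal.ofReal_le_ofReal (pow_le_pow_left₀ (by linarith [hs.1]) ?_ _)
        linarith [hs.2]
    _ = _ := by rw [setLIntegral_const, Real.volume_Ioo, add_sub_cancel_left]

lemma lintegral_fin_prod_eq_prod {n : ℕ} {E : Fin n → Type*} {mE : ∀ i, MeasurableSpace (E i)}
    {μ : ∀ i, Measure (E i)} [∀ i, SigmaFinite (μ i)] {f : ∀ i, E i → ℝ≥0∞}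
    (hf : ∀ i, Measurable (f i)) :
    ∫⁻ x, ∏ i, f i (x i) ∂(Measure.pi μ) = ∏ i, ∫⁻ x, f i x ∂(μ i) := by
  induction n with
  | zero => simp
  | succ n ih =>
    have htail : Measurable fun x : ∀ i : Fin n, E i.succ => ∏ i, f i.succ (x i) :=
      Finset.measurable_prod _ fun i _ => (hf i.succ).comp (measurable_pi_apply i)
    rw [Fin.prod_univ_succ, ← ih fun i => hf i.succ,
      ← lintegral_prod_mul (hf 0).aemeasurable htail.aemeasurable,
      ← (measurePreserving_piFinSuccAbove μ 0).symm.lintegral_comp_emb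
        (MeasurableEquiv.measurableEmbedding _)]
    simp only [MeasurableEquiv.piFinSuccAbove_symm_apply, Fin.insertNthEquiv, Fin.prod_univ_succ,
      Fin.insertNth_zero, Equiv.coe_fn_mk, Fin.cons_succ, Fin.cons_zero]
    rfl

section AbsoluteValue

lemma lintegral_comp_abs (F : ℝ → ℝ≥0∞) : ∫⁻ z, F |z| = 2 * ∫⁻ z in Ioi 0, F z := by
  have hpos : ∫⁻ z in Ioi 0, F |z| = ∫⁻ z in Ioi 0, F z :=
    setLIntegral_congr_fun measurableSet_Ioi fun z hz => by rw [abs_of_pos hz]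
  have hneg : ∫⁻ z in Iic 0, F |z| = ∫⁻ z in Ioi 0, F z := by
    have hmp := Measure.measurePreserving_neg (volume : Measure ℝ)
    rw [← hpos, ← hmp.setLIntegral_comp_preimage_emb (MeasurableEquiv.neg ℝ).measurableEmbedding]
    simp [Measure.restrict_congr_set Ioi_ae_eq_Ici]
  rw [← lintegral_add_compl _ (measurableSet_Iic (a := (0 : ℝ))), compl_Iic, hpos, hneg, two_mul]

lemma lintegral_Ioo_rpow {x q : ℝ} (hx : 0 ≤ x) (hq : 0 < q) :
    ∫⁻ t in Ioo 0 x, ENNReal.ofReal (t ^ (q - 1)) = ENNReal.ofReal (x ^ q / q) := by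
  have hint : IntervalIntegrable (fun t : ℝ => t ^ (q - 1)) volume 0 x :=
    intervalIntegral.intervalIntegrable_rpow' (by linarith)
  rw [Measure.restrict_congr_set Ioo_ae_eq_Ioc, ← ofReal_integral_eq_lintegral_ofReal hint.1,
    ← intervalIntegral.integral_of_le hx, integral_rpow (Or.inl (by linarith))]
  · simp [Real.zero_rpow hq.ne']
  · filter_upwards [ae_restrict_mem measurableSet_Ioc] with t ht
    exact Real.rpow_nonneg ht.1.le _

lemma rpow_le_rpow_abs_mul_rpow {u v l : ℝ} (α : ℝ) (hu : 0 < u) (hv : 0 < v) (huv : u ≤ l * v)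
    (hvu : v ≤ l * u) : u ^ α ≤ l ^ |α| * v ^ α := by
  have hl : 0 < l := pos_of_mul_pos_left (hu.trans_le huv) hv.le
  rcases le_total 0 α with h | h
  · rw [abs_of_nonneg h, ← Real.mul_rpow hl.le hv.le]
    exact Real.rpow_le_rpow hu.le huv h
  · rw [abs_of_nonpos h]
    have h2 : (l * u) ^ α ≤ v ^ α := Real.rpow_le_rpow_of_nonpos hv hvu h
    rw [Real.mul_rpow hl.le hu.le] at h2
    calc u ^ α = l ^ (-α) * (l ^ α * u ^ α) := by
          rw [← mul_assoc, ← Real.rpow_add hl]; simp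
      _ ≤ _ := by gcongr

lemma lintegral_Ioo_rpow_le_of_two_mul_le (α : ℝ) {a r : ℝ} (hr : 0 < r) (ha : 2 * r ≤ a) :
    ∫⁻ t in Ioo (a - r) (a + r), ENNReal.ofReal (t ^ α) ≤
      ENNReal.ofReal (2 * 3 ^ |α|) * ENNReal.ofReal (r * (a + r) ^ α) := by
  calc ∫⁻ t in Ioo (a - r) (a + r), ENNReal.ofReal (t ^ α)
      ≤ ∫⁻ _ in Ioo (a - r) (a + r), ENNReal.ofReal (3 ^ |α| * (a + r) ^ α) := by
        refine setLIntegral_mono' measurableSet_Ioo fun t ht => ENNReal.ofReal_le_ofReal ?_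
        exact rpow_le_rpow_abs_mul_rpow α (by linarith [ht.1]) (by linarith) (by linarith [ht.2])
          (by linarith [ht.1])
    _ = _ := by
        have : 0 ≤ a + r := by linarith
        rw [setLIntegral_const, Real.volume_Ioo, ← ENNReal.ofReal_mul (by positivity),
          ← ENNReal.ofReal_mul (by positivity)]
        congr 1; ring

lemma lintegral_Ioo_rpow_le_of_le_two_mul {α : ℝ} (hα : -1 < α) {a r : ℝ} (ha0 : 0 ≤ a)
    (hr : 0 < r) (ha : a ≤ 2 * r) :
    ∫⁻ t in Ioo 0 (a + r), ENNReal.ofReal (t ^ α) ≤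
      ENNReal.ofReal (3 / (α + 1)) * ENNReal.ofReal (r * (a + r) ^ α) := by
  have hα1 : 0 < α + 1 := by linarith
  have har : 0 < a + r := by linarith
  calc ∫⁻ t in Ioo 0 (a + r), ENNReal.ofReal (t ^ α)
      = ENNReal.ofReal ((a + r) ^ (α + 1) / (α + 1)) := by
        rw [← lintegral_Ioo_rpow har.le hα1, add_sub_cancel_right]
    _ ≤ ENNReal.ofReal (3 / (α + 1) * (r * (a + r) ^ α)) := by
        refine ENNReal.ofReal_le_ofReal ?_
        rw [Real.rpow_add_one har.ne', div_mul_eq_mul_div]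
        refine div_le_div_of_nonneg_right ?_ hα1.le
        nlinarith [Real.rpow_nonneg har.le α]
    _ = _ := ENNReal.ofReal_mul (by positivity)

lemma exists_setLIntegral_abs_rpow_le {α : ℝ} (hα : -1 < α) :
    ∃ C : ℝ≥0, ∀ a r : ℝ, 0 ≤ a → 0 < r →
      ∫⁻ t in {t : ℝ | abs (|t| - a) < r}, ENNReal.ofReal (|t| ^ α) ≤
        C * ENNReal.ofReal (r * (a + r) ^ α) := by
  refine ⟨2 * max (Real.toNNReal (2 * 3 ^ |α|)) (Real.toNNReal (3 / (α + 1))), fun a r ha hr => ?_⟩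
  have hmeas : MeasurableSet {t : ℝ | |t - a| < r} := measurableSet_lt (by fun_prop) (by fun_prop)
  have hmeas_abs : MeasurableSet {t : ℝ | abs (|t| - a) < r} :=
    measurableSet_lt (by fun_prop) (by fun_prop)
  rw [← lintegral_indicator hmeas_abs]
  have hfold := lintegral_comp_abs
    ({t : ℝ | |t - a| < r}.indicator fun t => ENNReal.ofReal (t ^ α))
  rw [lintegral_indicator hmeas, Measure.restrict_restrict hmeas] at hfold
  refine hfold.le.trans ?_
  rw [ENNReal.coe_mul, ENNReal.coe_ofNat, mul_assoc, ENNReal.coe_max]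
  gcongr
  rcases le_total (2 * r) a with h | h
  · refine (lintegral_mono_set fun t ht => ?_).trans
      ((lintegral_Ioo_rpow_le_of_two_mul_le α hr h).trans
        (mul_le_mul_left (le_max_left _ _) _))
    have := abs_lt.1 (show |t - a| < r from ht.1)
    exact ⟨by linarith, by linarith⟩
  · refine (lintegral_mono_set fun t ht => ?_).trans
      ((lintegral_Ioo_rpow_le_of_le_two_mul hα ha hr h).trans
        (mul_le_mul_left (le_max_right _ _) _))
    have := abs_lt.1 (show |t - a| < r from ht.1)
    exact ⟨ht.2, by linarith⟩

lemma ofReal_sub_le_volume_same_sign (x : ℝ) {a b : ℝ} (ha : 0 ≤ a) :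
    ENNReal.ofReal (b - a) ≤ volume {t : ℝ | 0 ≤ x * t ∧ |t| ∈ Ioo a b} := by
  rcases le_total 0 x with hx | hx
  · rw [← Real.volume_Ioo]
    refine measure_mono fun t ht => ?_
    have ht0 : 0 ≤ t := ha.trans ht.1.le
    exact ⟨mul_nonneg hx ht0, by rwa [abs_of_nonneg ht0]⟩
  · have hneg : b - a = -a - -b := by ring
    rw [hneg, ← Real.volume_Ioo]
    refine measure_mono fun t ht => ?_
    have ht0 : t ≤ 0 := by linarith [ht.2]
    exact ⟨mul_nonneg_of_nonpos_of_nonpos hx ht0, by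
      rw [abs_of_nonpos ht0]; exact ⟨by linarith [ht.2], by linarith [ht.1]⟩⟩

lemma abs_sub_eq_abs_abs_sub_abs {x t : ℝ} (h : 0 ≤ x * t) : |t - x| = abs (|t| - |x|) := by
  rw [← sq_eq_sq₀ (abs_nonneg _) (abs_nonneg _), sq_abs, sq_abs, sub_sq, sub_sq, sq_abs, sq_abs,
    mul_assoc, mul_assoc, ← abs_mul, abs_of_nonneg (by linarith : 0 ≤ t * x)]

end AbsoluteValue

section ProductDensity

variable {ι : Type*} [Fintype ι]

/-- The density `∏ i, |z_i| ^ (2 τ_i)` on `ℝ^ι`, which restricts to `h_τ²` on the sphere. -/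
def density (τ : ι → ℝ) (z : EuclideanSpace ℝ ι) : ℝ≥0∞ :=
  ∏ i, ENNReal.ofReal (|z i| ^ (2 * τ i))

@[fun_prop]
lemma measurable_density (τ : ι → ℝ) : Measurable (density τ) :=
  Finset.measurable_prod _ fun i _ => by fun_prop

lemma density_smul (τ : ι → ℝ) {c : ℝ} (hc : 0 < c) (z : EuclideanSpace ℝ ι) :
    density τ (c • z) = ENNReal.ofReal (c ^ ∑ i, 2 * τ i) * density τ z := by
  rw [density, density, Real.rpow_sum_of_pos hc,
    ENNReal.ofReal_prod_of_nonneg fun i _ => by positivity, ← Finset.prod_mul_distrib]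
  refine Finset.prod_congr rfl fun i _ => ?_
  rw [PiLp.smul_apply, smul_eq_mul, abs_mul, abs_of_pos hc,
    Real.mul_rpow hc.le (abs_nonneg _), ENNReal.ofReal_mul (by positivity)]

lemma density_smul_le (τ : ι → ℝ) {c l : ℝ} (hc : 0 < c) (hcl : c ≤ l) (hlc : 1 ≤ l * c)
    (z : EuclideanSpace ℝ ι) :
    density τ (c • z) ≤ ENNReal.ofReal (l ^ |∑ i, 2 * τ i|) * density τ z := by
  rw [density_smul τ hc]
  gcongr
  simpa using rpow_le_rpow_abs_mul_rpow (∑ i, 2 * τ i) hc one_pos (by simpa using hcl) hlc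

end ProductDensity

lemma setLIntegral_pi_prod {n : ℕ} {f : Fin n → ℝ → ℝ≥0∞} (hf : ∀ i, Measurable (f i))
    (s : Fin n → Set ℝ) :
    ∫⁻ z in {z : EuclideanSpace ℝ (Fin n) | ∀ i, z i ∈ s i}, ∏ i, f i (z i) =
      ∏ i, ∫⁻ t in s i, f i t := by
  have hpre : {z : EuclideanSpace ℝ (Fin n) | ∀ i, z i ∈ s i} = WithLp.ofLp ⁻¹' univ.pi s := by
    ext z; simp
  rw [hpre, (PiLp.volume_preserving_ofLp (Fin n)).setLIntegral_comp_preimage_emb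
      (MeasurableEquiv.toLp 2 _).symm.measurableEmbedding (fun z => ∏ i, f i (z i)),
    volume_pi, Measure.restrict_pi_pi, lintegral_fin_prod_eq_prod hf]

lemma ofReal_mul_rpow_le_setLIntegral {a b u l : ℝ} (α x : ℝ) (ha : 0 ≤ a) (hu : 0 < u)
    (hul : ∀ t ∈ Ioo a b, u ≤ l * t ∧ t ≤ l * u) :
    ENNReal.ofReal (b - a) * ENNReal.ofReal (u ^ α) ≤ ENNReal.ofReal (l ^ |α|) *
      ∫⁻ t in {t : ℝ | 0 ≤ x * t ∧ |t| ∈ Ioo a b}, ENNReal.ofReal (|t| ^ α) := by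
  have hmeas : MeasurableSet {t : ℝ | 0 ≤ x * t ∧ |t| ∈ Ioo a b} :=
    (measurableSet_le measurable_const (measurable_const_mul x)).inter
      (measurableSet_Ioo.preimage continuous_abs.measurable)
  calc ENNReal.ofReal (b - a) * ENNReal.ofReal (u ^ α)
      ≤ volume {t : ℝ | 0 ≤ x * t ∧ |t| ∈ Ioo a b} * ENNReal.ofReal (u ^ α) := by
        gcongr; exact ofReal_sub_le_volume_same_sign x ha
    _ = ∫⁻ _ in {t : ℝ | 0 ≤ x * t ∧ |t| ∈ Ioo a b}, ENNReal.ofReal (u ^ α) := by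
        rw [setLIntegral_const, mul_comm]
    _ ≤ ∫⁻ t in {t : ℝ | 0 ≤ x * t ∧ |t| ∈ Ioo a b},
          ENNReal.ofReal (l ^ |α|) * ENNReal.ofReal (|t| ^ α) := by
        refine setLIntegral_mono' hmeas fun t ht => ?_
        obtain ⟨hut, htu⟩ := hul |t| ht.2
        rw [← ENNReal.ofReal_mul' (by positivity)]
        exact ENNReal.ofReal_le_ofReal
          (rpow_le_rpow_abs_mul_rpow α hu (ha.trans_lt ht.2.1) hut htu)
    _ = _ := lintegral_const_mul _ (by fun_prop)

lemma ofReal_mul_rpow_le_setLIntegral_shifted (α x : ℝ) {N r R : ℝ} (hN : 2 ≤ N) (hr : 0 < r)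
    (hrR : r ≤ R) :
    ENNReal.ofReal (r * (|x| + r) ^ α) ≤ ENNReal.ofReal (N * (N * (1 + R)) ^ |α|) *
      ∫⁻ t in {t : ℝ | 0 ≤ x * t ∧
        |t| ∈ Ioo ((1 + r / 2) * |x| + r / N) ((1 + r / 2) * |x| + 2 * (r / N))},
        ENNReal.ofReal (|t| ^ α) := by
  have hx := abs_nonneg x
  have hrx : 0 ≤ r * |x| := by positivity
  have hNr : N * (r / N) = r := mul_div_cancel₀ r (by linarith)
  have hrN : 0 < r / N := by positivity
  have hlength : N * ((1 + r / 2) * |x| + 2 * (r / N) - ((1 + r / 2) * |x| + r / N)) = r := by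
    linear_combination hNr
  have hcomparable : ∀ t ∈ Ioo ((1 + r / 2) * |x| + r / N) ((1 + r / 2) * |x| + 2 * (r / N)),
      |x| + r ≤ N * (1 + R) * t ∧ t ≤ N * (1 + R) * (|x| + r) := by
    rintro t ⟨h1, h2⟩
    have ht : 0 < t := by linarith
    constructor
    · calc |x| + r ≤ N * (|x| + r / N) := by nlinarith
        _ ≤ N * t := by gcongr; linarith
        _ ≤ N * (1 + R) * t := by gcongr; nlinarith
    · calc t ≤ (1 + R) * (|x| + r) := by nlinarith
        _ ≤ N * (1 + R) * (|x| + r) := by gcongr; nlinarith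
  calc ENNReal.ofReal (r * (|x| + r) ^ α)
      = ENNReal.ofReal N * (ENNReal.ofReal ((1 + r / 2) * |x| + 2 * (r / N) -
          ((1 + r / 2) * |x| + r / N)) * ENNReal.ofReal ((|x| + r) ^ α)) := by
        rw [← mul_assoc, ← ENNReal.ofReal_mul (by linarith), hlength, ENNReal.ofReal_mul hr.le]
    _ ≤ _ := by
        rw [ENNReal.ofReal_mul (by linarith), mul_assoc (ENNReal.ofReal N)]
        exact mul_le_mul_right
          (ofReal_mul_rpow_le_setLIntegral α x (by positivity) (by positivity) hcomparable) _

/-- The unit sphere with the pseudometric `max_i ||x_i| - |y_i||`, which identifies points that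
differ by reflections in the coordinate hyperplanes. Since `h_κ` is invariant under these
reflections, `𝓜_κ` is controlled by the maximal function over the balls of this space. -/
def FoldedSphere (d : ℕ) : Type := UnitSphere d

namespace FoldedSphere

variable {d : ℕ}

instance : MeasurableSpace (FoldedSphere d) := inferInstanceAs (MeasurableSpace (UnitSphere d))

/-- The absolute values of the coordinates. -/
def fold (x : FoldedSphere d) (i : Fin (d + 1)) : ℝ := |x.1 i|

instance : PseudoMetricSpace (FoldedSphere d) := PseudoMetricSpace.induced fold inferInstance

lemma measurable_coord (i : Fin (d + 1)) : Measurable fun x : FoldedSphere d => x.1 i :=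
  show Measurable fun x : UnitSphere d => x.1 i by fun_prop

lemma measurable_fold : Measurable (fold : FoldedSphere d → Fin (d + 1) → ℝ) :=
  measurable_pi_lambda _ fun i => continuous_abs.measurable.comp (measurable_coord i)

lemma isInducing_fold : Topology.IsInducing (fold : FoldedSphere d → Fin (d + 1) → ℝ) := ⟨rfl⟩

instance : SecondCountableTopology (FoldedSphere d) := isInducing_fold.secondCountableTopology

instance : OpensMeasurableSpace (FoldedSphere d) := by
  refine ⟨MeasurableSpace.generateFrom_le fun s hs => ?_⟩
  obtain ⟨t, ht, rfl⟩ := isInducing_fold.isOpen_iff.1 hs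
  exact measurable_fold ht.measurableSet

lemma norm_eq_one (x : FoldedSphere d) : ‖x.1‖ = 1 := mem_sphere_zero_iff_norm.1 x.2

lemma abs_coord_le_one (x : FoldedSphere d) (i : Fin (d + 1)) : |x.1 i| ≤ 1 := by
  simpa only [norm_eq_one, Real.norm_eq_abs] using PiLp.norm_apply_le x.1 i

lemma mem_ball_iff {x y : FoldedSphere d} {r : ℝ} (hr : 0 < r) :
    y ∈ ball x r ↔ ∀ i, abs (|y.1 i| - |x.1 i|) < r :=
  dist_pi_lt_iff (f := fold y) (g := fold x) hr

lemma ball_eq_univ {x : FoldedSphere d} {r : ℝ} (hr : 2 ≤ r) : ball x r = univ := by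
  refine eq_univ_of_forall fun y => (mem_ball_iff (by linarith)).2 fun i => abs_lt.2 ?_
  have hx := abs_coord_le_one x i
  have hy := abs_coord_le_one y i
  exact ⟨by linarith [abs_nonneg (y.1 i)], by linarith [abs_nonneg (x.1 i)]⟩

instance : BoundedSpace (FoldedSphere d) := by
  refine ⟨?_⟩
  rcases isEmpty_or_nonempty (FoldedSphere d) with h | ⟨⟨x⟩⟩
  · rw [univ_eq_empty_iff.2 h]; exact Bornology.isBounded_empty
  · rw [← ball_eq_univ (x := x) le_rfl]; exact isBounded_ball

/-- The surface measure, on the folded sphere. -/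
def surface (d : ℕ) : Measure (FoldedSphere d) := surfaceMeasure d

/-- The measure `h_τ² dω`, on the folded sphere. -/
def measure (τ : Fin (d + 1) → ℝ) : Measure (FoldedSphere d) := weightedMeasure τ

lemma ofReal_productWeight_sq (τ : Fin (d + 1) → ℝ) (z : EuclideanSpace ℝ (Fin (d + 1))) :
    ENNReal.ofReal (productWeight τ z ^ 2) = density τ z := by
  rw [productWeight, density, ← Finset.prod_pow,
    ENNReal.ofReal_prod_of_nonneg fun i _ => by positivity]
  refine Finset.prod_congr rfl fun i _ => ?_
  rw [mul_comm, Real.rpow_mul (abs_nonneg _), Real.rpow_two]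

lemma measure_eq_withDensity (τ : Fin (d + 1) → ℝ) :
    measure τ = (surface d).withDensity fun x => density τ x.1 := by
  simp only [measure, weightedMeasure, ofReal_productWeight_sq]
  rfl

/-- The order of magnitude of the `h_τ² dω`-measure of the ball of radius `r` around `x`. -/
def ballSize (τ : Fin (d + 1) → ℝ) (x : FoldedSphere d) (r : ℝ) : ℝ :=
  r ^ d * ∏ i, (|x.1 i| + r) ^ (2 * τ i)

lemma ballSize_pos (τ : Fin (d + 1) → ℝ) (x : FoldedSphere d) {r : ℝ} (hr : 0 < r) :
    0 < ballSize τ x r :=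
  mul_pos (by positivity) (Finset.prod_pos fun i _ => by positivity)

lemma ballSize_mul_le (τ : Fin (d + 1) → ℝ) (x : FoldedSphere d) {l r : ℝ} (hl : 1 ≤ l)
    (hr : 0 < r) :
    ballSize τ x (l * r) ≤ (l ^ d * ∏ i, l ^ |2 * τ i|) * ballSize τ x r := by
  have hl0 : 0 < l := by linarith
  calc ballSize τ x (l * r)
      ≤ (l * r) ^ d * ∏ i, (l ^ |2 * τ i| * (|x.1 i| + r) ^ (2 * τ i)) := by
        refine mul_le_mul_of_nonneg_left (Finset.prod_le_prod (fun i _ => by positivity)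
          fun i _ => ?_) (by positivity)
        have hx := abs_nonneg (x.1 i)
        exact rpow_le_rpow_abs_mul_rpow _ (by positivity) (by positivity) (by nlinarith)
          (by nlinarith [mul_nonneg (sub_nonneg.2 hl) hr.le,
            mul_nonneg (sub_nonneg.2 hl) (mul_nonneg hl0.le hr.le)])
    _ = _ := by rw [Finset.prod_mul_distrib, ballSize, mul_pow]; ring

lemma prod_ofReal_mul_rpow_eq (τ : Fin (d + 1) → ℝ) (x : FoldedSphere d) {r : ℝ} (hr : 0 < r) :
    ∏ i, ENNReal.ofReal (r * (|x.1 i| + r) ^ (2 * τ i)) =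
      ENNReal.ofReal (ballSize τ x r) * ENNReal.ofReal r := by
  rw [← ENNReal.ofReal_prod_of_nonneg fun i _ => by positivity,
    ← ENNReal.ofReal_mul (ballSize_pos τ x hr).le, Finset.prod_mul_distrib, Finset.prod_const,
    Finset.card_univ, Fintype.card_fin, ballSize]
  ring_nf

section Cones

/-- The points of the shell `1 < ‖z‖ < 1 + r` whose radial projection to the sphere lies in `s`.
Its volume, weighted by `density τ`, is comparable to `r` times the measure of `s`, which reduces
estimates on the sphere to product integrals. -/
def coneShell (s : Set (EuclideanSpace ℝ (Fin (d + 1)))) (r : ℝ) :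
    Set (EuclideanSpace ℝ (Fin (d + 1))) :=
  norm ⁻¹' Ioo 1 (1 + r) ∩ (fun z => ‖z‖⁻¹ • z) ⁻¹' s

variable {s : Set (EuclideanSpace ℝ (Fin (d + 1)))}

lemma measurableSet_coneShell (hs : MeasurableSet s) (r : ℝ) : MeasurableSet (coneShell s r) :=
  (measurableSet_Ioo.preimage measurable_norm).inter (hs.preimage (by fun_prop))

lemma measure_mul_shell (τ : Fin (d + 1) → ℝ) (hs : MeasurableSet s) (r : ℝ) :
    measure τ {y : FoldedSphere d | y.1 ∈ s} * ∫⁻ t in Ioo 1 (1 + r), ENNReal.ofReal (t ^ d) =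
      ∫⁻ z in coneShell s r, density τ (‖z‖⁻¹ • z) := by
  have hs' : MeasurableSet {y : FoldedSphere d | y.1 ∈ s} :=
    show MeasurableSet {y : UnitSphere d | y.1 ∈ s} from measurable_subtype_coe hs
  have hpolar := setLIntegral_normalize_shell volume ((measurable_density τ).indicator hs)
    (a := 1) (b := 1 + r) zero_le_one
  rw [finrank_euclideanSpace_fin, Nat.add_sub_cancel] at hpolar
  rw [measure_eq_withDensity, withDensity_apply _ hs', ← lintegral_indicator hs', coneShell,
    inter_comm, ← Measure.restrict_restrict (hs.preimage (by fun_prop)),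
    ← lintegral_indicator (hs.preimage (by fun_prop))]
  exact hpolar.symm

lemma measure_mul_ofReal_le_coneShell (τ : Fin (d + 1) → ℝ) (hs : MeasurableSet s) {r R : ℝ}
    (hr : r ≤ R) :
    measure τ {y : FoldedSphere d | y.1 ∈ s} * ENNReal.ofReal r ≤
      ENNReal.ofReal ((1 + R) ^ |∑ i, 2 * τ i|) * ∫⁻ z in coneShell s r, density τ z := by
  calc measure τ {y : FoldedSphere d | y.1 ∈ s} * ENNReal.ofReal r
      ≤ ∫⁻ z in coneShell s r, density τ (‖z‖⁻¹ • z) := by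
        rw [← measure_mul_shell τ hs]; gcongr; exact le_lintegral_pow_shell d r
    _ ≤ ∫⁻ z in coneShell s r, ENNReal.ofReal ((1 + R) ^ |∑ i, 2 * τ i|) * density τ z := by
        refine setLIntegral_mono' (measurableSet_coneShell hs r) fun z hz => ?_
        obtain ⟨h1, h2⟩ := hz.1
        have hz0 : 0 < ‖z‖ := by linarith
        refine density_smul_le τ (inv_pos.2 hz0) ((inv_le_one_of_one_le₀ h1.le).trans ?_) ?_ z
        · linarith
        · rw [← div_eq_mul_inv, one_le_div hz0]; linarith
    _ = _ := lintegral_const_mul _ (by fun_prop)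

lemma coneShell_le_measure_mul_ofReal (τ : Fin (d + 1) → ℝ) (hs : MeasurableSet s) {r R : ℝ}
    (hr : r ≤ R) :
    ∫⁻ z in coneShell s r, density τ z ≤ ENNReal.ofReal ((1 + R) ^ |∑ i, 2 * τ i|) *
      ENNReal.ofReal ((1 + R) ^ d) * measure τ {y : FoldedSphere d | y.1 ∈ s} *
        ENNReal.ofReal r := by
  calc ∫⁻ z in coneShell s r, density τ z
      ≤ ∫⁻ z in coneShell s r,
          ENNReal.ofReal ((1 + R) ^ |∑ i, 2 * τ i|) * density τ (‖z‖⁻¹ • z) := by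
        refine setLIntegral_mono' (measurableSet_coneShell hs r) fun z hz => ?_
        obtain ⟨h1, h2⟩ := hz.1
        have hz0 : 0 < ‖z‖ := by linarith
        have hle := density_smul_le τ (l := 1 + R) hz0 (by linarith) (by nlinarith) (‖z‖⁻¹ • z)
        rwa [smul_inv_smul₀ hz0.ne'] at hle
    _ = ENNReal.ofReal ((1 + R) ^ |∑ i, 2 * τ i|) * (measure τ {y : FoldedSphere d | y.1 ∈ s} *
          ∫⁻ t in Ioo 1 (1 + r), ENNReal.ofReal (t ^ d)) := by
        rw [lintegral_const_mul _ (by fun_prop), measure_mul_shell τ hs]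
    _ ≤ ENNReal.ofReal ((1 + R) ^ |∑ i, 2 * τ i|) * (measure τ {y : FoldedSphere d | y.1 ∈ s} *
          (ENNReal.ofReal ((1 + R) ^ d) * ENNReal.ofReal r)) := by
        gcongr; exact lintegral_pow_shell_le d hr
    _ = _ := by ring

end Cones

section UpperBound

/-- The condition defining `ball x r`, for points of the ambient space. -/
def nearSet (x : FoldedSphere d) (r : ℝ) : Set (EuclideanSpace ℝ (Fin (d + 1))) :=
  {z | ∀ i, z i ∈ {t : ℝ | abs (|t| - |x.1 i|) < r}}

lemma ball_eq_nearSet (x : FoldedSphere d) {r : ℝ} (hr : 0 < r) :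
    ball x r = {y : FoldedSphere d | y.1 ∈ nearSet x r} :=
  Set.ext fun _ => mem_ball_iff hr

lemma measurableSet_nearSet (x : FoldedSphere d) (r : ℝ) : MeasurableSet (nearSet x r) := by
  simp only [nearSet, mem_ofPred_eq, ofPred_forall]
  exact MeasurableSet.iInter fun i => measurableSet_lt (by fun_prop) (by fun_prop)

lemma coneShell_nearSet_subset (x : FoldedSphere d) (r : ℝ) :
    coneShell (nearSet x r) r ⊆ nearSet x (2 * r) := by
  rintro z ⟨⟨h1, h2⟩, hz⟩ i
  have hz0 : 0 < ‖z‖ := by linarith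
  have hi : abs (|(‖z‖⁻¹ • z) i| - |x.1 i|) < r := hz i
  rw [PiLp.smul_apply, smul_eq_mul, abs_mul, abs_of_pos (inv_pos.2 hz0)] at hi
  have hzi : |z i| ≤ ‖z‖ := PiLp.norm_apply_le z i
  have hproj : abs (|z i| - ‖z‖⁻¹ * |z i|) ≤ ‖z‖ - 1 := by
    have h : |z i| - ‖z‖⁻¹ * |z i| = (‖z‖ - 1) * (|z i| / ‖z‖) := by field_simp
    rw [h, abs_of_nonneg (mul_nonneg (by linarith) (by positivity))]
    exact mul_le_of_le_one_right (by linarith) ((div_le_one hz0).2 hzi)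
  calc abs (|z i| - |x.1 i|)
      ≤ abs (|z i| - ‖z‖⁻¹ * |z i|) + abs (‖z‖⁻¹ * |z i| - |x.1 i|) := abs_sub_le _ _ _
    _ < 2 * r := by linarith

lemma exists_setLIntegral_nearSet_le {τ : Fin (d + 1) → ℝ} (hτ : ∀ i, -(1 / 2) < τ i) :
    ∃ C : ℝ≥0, ∀ (x : FoldedSphere d) (r : ℝ), 0 < r →
      ∫⁻ z in nearSet x r, density τ z ≤
        C * (ENNReal.ofReal (ballSize τ x r) * ENNReal.ofReal r) := by
  choose C hC using fun i =>
    exists_setLIntegral_abs_rpow_le (α := 2 * τ i) (by linarith [hτ i])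
  refine ⟨∏ i, C i, fun x r hr => ?_⟩
  calc ∫⁻ z in nearSet x r, density τ z
      = ∏ i, ∫⁻ t in {t : ℝ | abs (|t| - |x.1 i|) < r}, ENNReal.ofReal (|t| ^ (2 * τ i)) :=
        setLIntegral_pi_prod (f := fun i t => ENNReal.ofReal (|t| ^ (2 * τ i)))
          (fun i => by fun_prop) _
    _ ≤ ∏ i, (C i * ENNReal.ofReal (r * (|x.1 i| + r) ^ (2 * τ i))) :=
        Finset.prod_le_prod' fun i _ => hC i _ r (abs_nonneg _) hr
    _ = _ := by
        rw [Finset.prod_mul_distrib, prod_ofReal_mul_rpow_eq τ x hr, ENNReal.ofNNReal_finsetProd]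

lemma exists_measure_ball_le {τ : Fin (d + 1) → ℝ} (hτ : ∀ i, -(1 / 2) < τ i) (R : ℝ) :
    ∃ C : ℝ≥0, ∀ (x : FoldedSphere d) (r : ℝ), 0 < r → r ≤ R →
      measure τ (ball x r) ≤ C * ENNReal.ofReal (ballSize τ x r) := by
  obtain ⟨C, hC⟩ := exists_setLIntegral_nearSet_le hτ
  set A : ℝ≥0∞ := ENNReal.ofReal ((1 + R) ^ |∑ i, 2 * τ i|)
  set L : ℝ := 2 ^ d * ∏ i, 2 ^ |2 * τ i|
  have hL : 0 ≤ L := mul_nonneg (by positivity) (Finset.prod_nonneg fun i _ => by positivity)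
  refine ⟨(A * C * ENNReal.ofReal L * 2).toNNReal, fun x r hr hrR => ?_⟩
  rw [ENNReal.coe_toNNReal (by finiteness)]
  refine (ENNReal.mul_le_mul_iff_left (c := ENNReal.ofReal r) (by simpa using hr)
    ENNReal.ofReal_ne_top).1 ?_
  calc measure τ (ball x r) * ENNReal.ofReal r
      ≤ A * ∫⁻ z in coneShell (nearSet x r) r, density τ z := by
        rw [ball_eq_nearSet x hr]
        exact measure_mul_ofReal_le_coneShell τ (measurableSet_nearSet x r) hrR
    _ ≤ A * (C * (ENNReal.ofReal (ballSize τ x (2 * r)) * ENNReal.ofReal (2 * r))) := by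
        gcongr
        exact (lintegral_mono_set (coneShell_nearSet_subset x r)).trans (hC x _ (by linarith))
    _ ≤ A * (C * (ENNReal.ofReal (L * ballSize τ x r) * ENNReal.ofReal (2 * r))) := by
        gcongr
        exact ballSize_mul_le τ x one_le_two hr
    _ = A * C * ENNReal.ofReal L * 2 * ENNReal.ofReal (ballSize τ x r) * ENNReal.ofReal r := by
        rw [ENNReal.ofReal_mul hL, ENNReal.ofReal_mul zero_le_two, ENNReal.ofReal_ofNat]
        ring

end UpperBound

section LowerBound

/-- The condition defining `signedBall x r`, for points of the ambient space. -/
def signedNearSet (x : FoldedSphere d) (r : ℝ) : Set (EuclideanSpace ℝ (Fin (d + 1))) :=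
  {z | ∀ i, abs (|z i| - |x.1 i|) < r ∧ 0 ≤ x.1 i * z i}

/-- The points of the ball around `x` whose coordinates have the same signs as those of `x`. -/
def signedBall (x : FoldedSphere d) (r : ℝ) : Set (FoldedSphere d) :=
  {y | y.1 ∈ signedNearSet x r}

lemma measurableSet_signedNearSet (x : FoldedSphere d) (r : ℝ) :
    MeasurableSet (signedNearSet x r) := by
  simp only [signedNearSet, ofPred_forall, ofPred_and]
  exact MeasurableSet.iInter fun i => (measurableSet_lt (by fun_prop) (by fun_prop)).inter
    (measurableSet_le (by fun_prop) (by fun_prop))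

lemma signedBall_subset {x : FoldedSphere d} {r : ℝ} (hr : 0 < r) : signedBall x r ⊆ ball x r :=
  fun _ hy => (mem_ball_iff hr).2 fun i => (hy i).1

lemma norm_le_card_mul_of_abs_le {n : ℕ} {v : EuclideanSpace ℝ (Fin n)} {ρ : ℝ}
    (hv : ∀ i, |v i| ≤ ρ) : ‖v‖ ≤ n * ρ := by
  calc ‖v‖ = ‖∑ i, v i • EuclideanSpace.basisFun (Fin n) ℝ i‖ :=
        congrArg norm ((EuclideanSpace.basisFun (Fin n) ℝ).sum_repr v).symm
    _ ≤ ∑ i, ‖v i • EuclideanSpace.basisFun (Fin n) ℝ i‖ := norm_sum_le _ _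
    _ ≤ ∑ _i : Fin n, ρ := Finset.sum_le_sum fun i _ => by simpa [norm_smul] using hv i
    _ = n * ρ := by simp

/-- A box near `(1 + r / 2) x`, in the same orthant as `x` and at distance at least `ρ` from the
coordinate hyperplanes. -/
def shiftedBox (x : FoldedSphere d) (r ρ : ℝ) : Set (EuclideanSpace ℝ (Fin (d + 1))) :=
  {z | ∀ i, z i ∈ {t : ℝ | 0 ≤ x.1 i * t ∧
    |t| ∈ Ioo ((1 + r / 2) * |x.1 i| + ρ) ((1 + r / 2) * |x.1 i| + 2 * ρ)}}

lemma abs_norm_sub_le_of_mem_shiftedBox {x : FoldedSphere d} {r ρ : ℝ} (hr : 0 < r) (hρ : 0 < ρ)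
    {z : EuclideanSpace ℝ (Fin (d + 1))} (hz : z ∈ shiftedBox x r ρ) :
    |‖z‖ - (1 + r / 2)| ≤ (d + 1) * (2 * ρ) := by
  have hnorm : ‖(1 + r / 2) • x.1‖ = 1 + r / 2 := by
    rw [norm_smul, norm_eq_one, mul_one, Real.norm_eq_abs, abs_of_pos (by linarith)]
  have hcoord : ∀ i, |(z - (1 + r / 2) • x.1) i| ≤ 2 * ρ := fun i => by
    obtain ⟨hsign, h1, h2⟩ := hz i
    rw [PiLp.sub_apply, PiLp.smul_apply, smul_eq_mul, abs_sub_eq_abs_abs_sub_abs (by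
      rw [mul_assoc]; positivity), abs_mul, abs_of_pos (by linarith : 0 < 1 + r / 2), abs_le]
    exact ⟨by linarith, by linarith⟩
  rw [← hnorm]
  exact_mod_cast (abs_norm_sub_norm_le _ _).trans (norm_le_card_mul_of_abs_le hcoord)

lemma shiftedBox_subset_coneShell (x : FoldedSphere d) {r ρ : ℝ} (hρ : 0 < ρ)
    (hρr : (d + 1) * (2 * ρ) ≤ r / 4) :
    shiftedBox x r ρ ⊆ coneShell (signedNearSet x r) r := by
  intro z hz
  have hρd : 2 * ρ ≤ (d + 1) * (2 * ρ) :=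
    le_mul_of_one_le_left (by linarith) (by linarith [Nat.cast_nonneg (α := ℝ) d])
  have hr : 0 < r := by linarith
  obtain ⟨hn1, hn2⟩ := abs_le.1 (abs_norm_sub_le_of_mem_shiftedBox hr hρ hz)
  have hz0 : 0 < ‖z‖ := by linarith
  refine ⟨⟨by linarith, by linarith⟩, fun i => ?_⟩
  obtain ⟨hsign, h1, h2⟩ := hz i
  have hx0 := abs_nonneg (x.1 i)
  have hx1 := abs_coord_le_one x i
  rw [PiLp.smul_apply, smul_eq_mul, abs_mul, abs_of_pos (inv_pos.2 hz0), mul_left_comm]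
  refine ⟨?_, by positivity⟩
  have hscale : ‖z‖⁻¹ * |z i| - |x.1 i| = ‖z‖⁻¹ * (|z i| - ‖z‖ * |x.1 i|) := by field_simp
  have hdiff : abs (|z i| - ‖z‖ * |x.1 i|) < r := abs_lt.2 ⟨by nlinarith, by nlinarith⟩
  rw [hscale, abs_mul, abs_of_pos (inv_pos.2 hz0), inv_mul_lt_iff₀ hz0]
  nlinarith

lemma ballSize_le_setLIntegral_shiftedBox (τ : Fin (d + 1) → ℝ) (x : FoldedSphere d) {N r R : ℝ}
    (hN : 2 ≤ N) (hr : 0 < r) (hrR : r ≤ R) :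
    ENNReal.ofReal (ballSize τ x r) * ENNReal.ofReal r ≤
      (∏ i, ENNReal.ofReal (N * (N * (1 + R)) ^ |2 * τ i|)) *
        ∫⁻ z in shiftedBox x r (r / N), density τ z := by
  calc ENNReal.ofReal (ballSize τ x r) * ENNReal.ofReal r
      = ∏ i, ENNReal.ofReal (r * (|x.1 i| + r) ^ (2 * τ i)) :=
        (prod_ofReal_mul_rpow_eq τ x hr).symm
    _ ≤ _ := Finset.prod_le_prod' fun i _ =>
        ofReal_mul_rpow_le_setLIntegral_shifted (2 * τ i) (x.1 i) hN hr hrR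
    _ = _ := by
        rw [Finset.prod_mul_distrib]
        congr 1
        exact (setLIntegral_pi_prod (f := fun i t => ENNReal.ofReal (|t| ^ (2 * τ i)))
          (fun i => by fun_prop) _).symm

lemma exists_ballSize_le_measure_signedBall (τ : Fin (d + 1) → ℝ) (R : ℝ) :
    ∃ C : ℝ≥0, ∀ (x : FoldedSphere d) (r : ℝ), 0 < r → r ≤ R →
      ENNReal.ofReal (ballSize τ x r) ≤ C * measure τ (signedBall x r) := by
  set A : ℝ≥0∞ := ∏ i, ENNReal.ofReal (8 * (d + 1) * (8 * (d + 1) * (1 + R)) ^ |2 * τ i|)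
  have hN : (2 : ℝ) ≤ 8 * (d + 1) := by linarith [Nat.cast_nonneg (α := ℝ) d]
  have hA : A ≠ ∞ := (ENNReal.prod_lt_top fun _ _ => ENNReal.ofReal_lt_top).ne
  set B : ℝ≥0∞ := ENNReal.ofReal ((1 + R) ^ |∑ i, 2 * τ i|) * ENNReal.ofReal ((1 + R) ^ d)
  have hB : B ≠ ∞ := ENNReal.mul_ne_top ENNReal.ofReal_ne_top ENNReal.ofReal_ne_top
  refine ⟨(A * B).toNNReal, fun x r hr hrR => ?_⟩
  rw [ENNReal.coe_toNNReal (ENNReal.mul_ne_top hA hB)]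
  refine (ENNReal.mul_le_mul_iff_left (c := ENNReal.ofReal r) (by simpa using hr)
    ENNReal.ofReal_ne_top).1 ?_
  calc ENNReal.ofReal (ballSize τ x r) * ENNReal.ofReal r
      ≤ A * ∫⁻ z in shiftedBox x r (r / (8 * (d + 1))), density τ z :=
        ballSize_le_setLIntegral_shiftedBox τ x hN hr hrR
    _ ≤ A * ∫⁻ z in coneShell (signedNearSet x r) r, density τ z := by
        gcongr
        exact shiftedBox_subset_coneShell x (by positivity) (le_of_eq (by field_simp; norm_num))
    _ ≤ A * (B * measure τ (signedBall x r) * ENNReal.ofReal r) := by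
        gcongr
        exact coneShell_le_measure_mul_ofReal τ (measurableSet_signedNearSet x r) hrR
    _ = _ := by ring

end LowerBound

variable {κ τ σ : Fin (d + 1) → ℝ}

lemma exists_measure_ball_mul_le (hτ : ∀ i, -(1 / 2) < τ i) {l : ℝ} (hl : 1 ≤ l) (R : ℝ) :
    ∃ C : ℝ≥0, ∀ (x : FoldedSphere d) (r : ℝ), 0 < r → l * r ≤ R →
      measure τ (ball x (l * r)) ≤ C * measure τ (signedBall x r) := by
  obtain ⟨C, hC⟩ := exists_measure_ball_le hτ R
  obtain ⟨C', hC'⟩ := exists_ballSize_le_measure_signedBall τ R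
  set L : ℝ := l ^ d * ∏ i, l ^ |2 * τ i|
  have hL : 0 ≤ L := mul_nonneg (by positivity) (Finset.prod_nonneg fun i _ => by positivity)
  refine ⟨C * L.toNNReal * C', fun x r hr hlr => ?_⟩
  calc measure τ (ball x (l * r))
      ≤ C * ENNReal.ofReal (ballSize τ x (l * r)) := hC x _ (by positivity) hlr
    _ ≤ C * (ENNReal.ofReal L * ENNReal.ofReal (ballSize τ x r)) := by
        rw [← ENNReal.ofReal_mul hL]; gcongr; exact ballSize_mul_le τ x hl hr
    _ ≤ C * (ENNReal.ofReal L * (C' * measure τ (signedBall x r))) := by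
        gcongr; exact hC' x r hr ((le_mul_of_one_le_left hr.le hl).trans hlr)
    _ = _ := by rw [ENNReal.ofReal]; push_cast; ring

lemma isFiniteMeasure_measure (hτ : ∀ i, -(1 / 2) < τ i) : IsFiniteMeasure (measure τ) := by
  obtain ⟨C, hC⟩ := exists_measure_ball_le hτ 2
  refine ⟨?_⟩
  rcases isEmpty_or_nonempty (FoldedSphere d) with h | ⟨⟨x⟩⟩
  · simp [univ_eq_empty_iff.2 h]
  · rw [← ball_eq_univ (x := x) le_rfl]
    exact (hC x 2 two_pos le_rfl).trans_lt (by finiteness)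

lemma measure_signedBall_pos (τ : Fin (d + 1) → ℝ) (x : FoldedSphere d) {r : ℝ} (hr : 0 < r) :
    0 < measure τ (signedBall x r) := by
  obtain ⟨C, hC⟩ := exists_ballSize_le_measure_signedBall τ r
  have hpos := (ENNReal.ofReal_pos.2 (ballSize_pos τ x hr)).trans_le (hC x r hr le_rfl)
  exact pos_of_mul_pos_right hpos zero_le

lemma exists_hasDoublingBalls (hτ : ∀ i, -(1 / 2) < τ i) :
    ∃ D : ℝ≥0, HasDoublingBalls (measure τ) D := by
  have := isFiniteMeasure_measure hτ
  obtain ⟨C, hC⟩ := exists_measure_ball_mul_le hτ one_le_two 4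
  refine ⟨C + 1, fun x r hr => ?_, fun x r => measure_lt_top _ _, fun x r hr => ?_⟩
  · exact (measure_signedBall_pos τ x hr).trans_le (measure_mono (signedBall_subset hr))
  · rcases le_or_gt 2 r with h2 | h2
    · rw [ball_eq_univ h2, ball_eq_univ (by linarith)]
      exact le_mul_of_one_le_left zero_le (by simp)
    · calc measure τ (ball x (2 * r)) ≤ C * measure τ (signedBall x r) := hC x r hr (by linarith)
        _ ≤ _ := by gcongr; exacts [by simp, signedBall_subset hr]

section PowerWeights

lemma volume_coord_eq_zero (i : Fin (d + 1)) :
    volume {z : EuclideanSpace ℝ (Fin (d + 1)) | z i = 0} = 0 := by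
  have hpre := (PiLp.volume_preserving_ofLp (Fin (d + 1))).measure_preimage
    (s := {f : Fin (d + 1) → ℝ | f i = 0})
    (measurableSet_eq_fun (by fun_prop) (by fun_prop)).nullMeasurableSet
  rwa [volume_pi, Measure.pi_hyperplane] at hpre

lemma ae_coord_ne_zero : ∀ᵐ x ∂(surface d), ∀ i, x.1 i ≠ 0 := by
  refine ae_all_iff.2 fun i => ?_
  suffices hnull : surface d {x | x.1 i = 0} = 0 from measure_eq_zero_iff_ae_notMem.1 hnull
  set s : Set (EuclideanSpace ℝ (Fin (d + 1))) := {z | z i = 0}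
  have hsurface : measure (0 : Fin (d + 1) → ℝ) = surface d := by
    simp [measure_eq_withDensity, density]
  have hcone : volume (coneShell s 1) = 0 := by
    refine measure_mono_null (fun z hz => ?_) (volume_coord_eq_zero i)
    have hz0 : 0 < ‖z‖ := one_pos.trans hz.1.1
    exact (mul_eq_zero.1 (show ‖z‖⁻¹ * z i = 0 from hz.2)).resolve_left (by positivity)
  have hle := measure_mul_ofReal_le_coneShell (d := d) 0
    (measurableSet_eq_fun (by fun_prop) (by fun_prop) : MeasurableSet s) (le_refl 1)
  rw [setLIntegral_measure_zero _ _ hcone] at hle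
  simpa [hsurface, s] using hle

lemma density_ne_zero (α : Fin (d + 1) → ℝ) {z : EuclideanSpace ℝ (Fin (d + 1))}
    (hz : ∀ i, z i ≠ 0) : density α z ≠ 0 :=
  Finset.prod_ne_zero_iff.2 fun i _ =>
    (ENNReal.ofReal_pos.2 (Real.rpow_pos_of_pos (abs_pos.2 (hz i)) _)).ne'

lemma density_ne_top (α : Fin (d + 1) → ℝ) (z : EuclideanSpace ℝ (Fin (d + 1))) :
    density α z ≠ ∞ :=
  (ENNReal.prod_lt_top fun _ _ => ENNReal.ofReal_lt_top).ne

lemma density_add (α β : Fin (d + 1) → ℝ) {z : EuclideanSpace ℝ (Fin (d + 1))}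
    (hz : ∀ i, z i ≠ 0) : density (α + β) z = density α z * density β z := by
  simp only [density, ← Finset.prod_mul_distrib]
  refine Finset.prod_congr rfl fun i _ => ?_
  rw [← ENNReal.ofReal_mul (by positivity), ← Real.rpow_add (abs_pos.2 (hz i)), Pi.add_apply,
    mul_add]

lemma density_smul_exponent (α : Fin (d + 1) → ℝ) (t : ℝ) {z : EuclideanSpace ℝ (Fin (d + 1))}
    (hz : ∀ i, z i ≠ 0) : density (t • α) z = density α z ^ t := by
  rw [density, density, ← ENNReal.prod_rpow_of_ne_top fun _ _ => ENNReal.ofReal_ne_top]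
  refine Finset.prod_congr rfl fun i _ => ?_
  rw [ENNReal.ofReal_rpow_of_pos (Real.rpow_pos_of_pos (abs_pos.2 (hz i)) _),
    ← Real.rpow_mul (abs_nonneg _), Pi.smul_apply, smul_eq_mul, mul_left_comm, mul_comm t]

@[fun_prop]
lemma measurable_density_val (α : Fin (d + 1) → ℝ) :
    Measurable fun x : FoldedSphere d => density α x.1 :=
  show Measurable fun x : UnitSphere d => density α x.1 by fun_prop

lemma measure_absolutelyContinuous_surface (κ : Fin (d + 1) → ℝ) : measure κ ≪ surface d := by
  rw [measure_eq_withDensity]; exact withDensity_absolutelyContinuous _ _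

lemma withDensity_density_rpow (κ α : Fin (d + 1) → ℝ) (t : ℝ) :
    (measure κ).withDensity (fun x => density α x.1 ^ t) = measure (κ + t • α) := by
  rw [measure_eq_withDensity, measure_eq_withDensity,
    ← withDensity_mul _ (by fun_prop) (by fun_prop)]
  refine withDensity_congr_ae ?_
  filter_upwards [ae_coord_ne_zero] with x hx
  rw [density_add κ _ hx, density_smul_exponent α t hx, Pi.mul_apply]

lemma withDensity_density_sub (κ τ : Fin (d + 1) → ℝ) :
    (measure κ).withDensity (fun x => density (τ - κ) x.1) = measure τ := by
  simpa using withDensity_density_rpow κ (τ - κ) 1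

lemma ae_density_ne_zero_and_ne_top (κ α : Fin (d + 1) → ℝ) :
    ∀ᵐ x ∂(measure κ), density α x.1 ≠ 0 ∧ density α x.1 ≠ ∞ := by
  filter_upwards [(measure_absolutelyContinuous_surface κ).ae_le ae_coord_ne_zero] with x hx
  exact ⟨density_ne_zero α hx, density_ne_top α x.1⟩

lemma measure_absolutelyContinuous (κ τ : Fin (d + 1) → ℝ) : measure κ ≪ measure τ := by
  rw [← withDensity_density_sub κ τ]
  exact withDensity_absolutelyContinuous' (by fun_prop)
    ((ae_density_ne_zero_and_ne_top κ (τ - κ)).mono fun x hx => hx.1)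

end PowerWeights

section Muckenhoupt

lemma ballSize_rpow (τ : Fin (d + 1) → ℝ) (x : FoldedSphere d) {r : ℝ} (hr : 0 < r) (t : ℝ) :
    ballSize τ x r ^ t = r ^ (d * t) * ∏ i, (|x.1 i| + r) ^ (2 * τ i * t) := by
  rw [ballSize, Real.mul_rpow (by positivity) (Finset.prod_nonneg fun i _ => by positivity),
    ← Real.finsetProd_rpow _ _ (fun i _ => by positivity), ← Real.rpow_natCast,
    ← Real.rpow_mul hr.le]
  congr 1
  exact Finset.prod_congr rfl fun i _ => (Real.rpow_mul (by positivity) _ _).symm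

lemma ballSize_rpow_mul_ballSize_rpow (τ σ : Fin (d + 1) → ℝ) (x : FoldedSphere d) {r a b : ℝ}
    (hr : 0 < r) (hab : a + b = 1) :
    ballSize τ x r ^ a * ballSize σ x r ^ b = ballSize (a • τ + b • σ) x r := by
  rw [ballSize_rpow τ x hr, ballSize_rpow σ x hr, mul_mul_mul_comm, ← Real.rpow_add hr,
    ← mul_add, hab, mul_one, Real.rpow_natCast, ← Finset.prod_mul_distrib, ballSize]
  congr 1
  refine Finset.prod_congr rfl fun i _ => ?_
  rw [← Real.rpow_add (by positivity)]
  congr 1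
  simp only [Pi.add_apply, Pi.smul_apply, smul_eq_mul]
  ring

lemma exists_measure_ball_rpow_mul_le (hτ : ∀ i, -(1 / 2) < τ i) (hσ : ∀ i, -(1 / 2) < σ i)
    {a b : ℝ} (ha : 0 ≤ a) (hb : 0 ≤ b) (hab : a + b = 1) :
    ∃ K : ℝ≥0, ∀ (x : FoldedSphere d) (r : ℝ), 0 < r →
      measure τ (ball x r) ^ a * measure σ (ball x r) ^ b ≤
        K * measure (a • τ + b • σ) (ball x r) := by
  obtain ⟨C₁, h₁⟩ := exists_measure_ball_le hτ 2
  obtain ⟨C₂, h₂⟩ := exists_measure_ball_le hσ 2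
  obtain ⟨C₃, h₃⟩ := exists_ballSize_le_measure_signedBall (a • τ + b • σ) 2
  have hsmall : ∀ (x : FoldedSphere d) (r : ℝ), 0 < r → r ≤ 2 →
      measure τ (ball x r) ^ a * measure σ (ball x r) ^ b ≤
        (C₁ ^ a * C₂ ^ b * C₃ : ℝ≥0) * measure (a • τ + b • σ) (ball x r) := by
    intro x r hr hr2
    calc measure τ (ball x r) ^ a * measure σ (ball x r) ^ b
        ≤ (C₁ * ENNReal.ofReal (ballSize τ x r)) ^ a *
            (C₂ * ENNReal.ofReal (ballSize σ x r)) ^ b := by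
          gcongr; exacts [h₁ x r hr hr2, h₂ x r hr hr2]
      _ = C₁ ^ a * C₂ ^ b * ENNReal.ofReal (ballSize (a • τ + b • σ) x r) := by
          have hτr := ballSize_pos τ x hr
          have hσr := ballSize_pos σ x hr
          rw [← ballSize_rpow_mul_ballSize_rpow τ σ x hr hab, ENNReal.mul_rpow_of_nonneg _ _ ha,
            ENNReal.mul_rpow_of_nonneg _ _ hb, ENNReal.ofReal_rpow_of_pos hτr,
            ENNReal.ofReal_rpow_of_pos hσr, mul_mul_mul_comm, ← ENNReal.ofReal_mul (by positivity)]
      _ ≤ C₁ ^ a * C₂ ^ b * (C₃ * measure (a • τ + b • σ) (ball x r)) := by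
          gcongr
          exact (h₃ x r hr hr2).trans (by gcongr; exact signedBall_subset hr)
      _ = _ := by
          rw [ENNReal.coe_mul, ENNReal.coe_mul, ENNReal.coe_rpow_of_nonneg _ ha,
            ENNReal.coe_rpow_of_nonneg _ hb, mul_assoc _ (C₃ : ℝ≥0∞)]
  refine ⟨C₁ ^ a * C₂ ^ b * C₃, fun x r hr => ?_⟩
  rcases le_or_gt r 2 with hr2 | hr2
  · exact hsmall x r hr hr2
  · have huniv := hsmall x 2 two_pos le_rfl
    rwa [ball_eq_univ le_rfl, ← ball_eq_univ (x := x) hr2.le] at huniv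

lemma isMuckenhoupt_density {r : ℝ} (hr : 1 < r) (hτ : ∀ i, -(1 / 2) < τ i)
    (hτr : ∀ i, τ i < r * κ i + (r - 1) / 2) :
    IsMuckenhoupt (measure κ) (fun x => density (τ - κ) x.1) r := by
  have hr0 : 0 < r - 1 := by linarith
  have hconj : r.HolderConjugate r.conjExponent := .conjExponent hr
  set σ : Fin (d + 1) → ℝ := κ + (1 - r.conjExponent) • (τ - κ) with hσ
  have hσi : ∀ i, σ i = (r * κ i - τ i) / (r - 1) := fun i => by
    simp only [hσ, Pi.add_apply, Pi.smul_apply, Pi.sub_apply, smul_eq_mul, Real.conjExponent]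
    field_simp
    ring
  have hκ : (1 / r) • τ + (1 / r.conjExponent) • σ = κ := by
    ext i
    simp only [Pi.add_apply, Pi.smul_apply, smul_eq_mul, hσi, Real.conjExponent]
    field_simp
    ring
  rw [IsMuckenhoupt, withDensity_density_sub, withDensity_density_rpow, ← hσ]
  have hσ_gt : ∀ i, -(1 / 2) < σ i := fun i => by
    rw [hσi, lt_div_iff₀ hr0]
    linarith [hτr i]
  simpa only [hκ] using exists_measure_ball_rpow_mul_le hτ hσ_gt hconj.one_div_nonneg
    hconj.symm.one_div_nonneg (by simpa using hconj.inv_add_inv_eq_one)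

lemma exists_exponent_lt {s : ℝ} (hs : 1 < s) (hτ : ∀ i, τ i < s * κ i + (s - 1) / 2) :
    ∃ r, 1 < r ∧ r < s ∧ ∀ i, τ i < r * κ i + (r - 1) / 2 := by
  have hnear : ∀ᶠ r in nhdsWithin s (Iio s), ∀ i, τ i < r * κ i + (r - 1) / 2 := by
    refine Filter.eventually_all.2 fun i => nhdsWithin_le_nhds ?_
    have hcont : Continuous fun r : ℝ => r * κ i + (r - 1) / 2 := by fun_prop
    exact hcont.continuousAt.eventually (lt_mem_nhds (hτ i))
  have hgt : ∀ᶠ r in nhdsWithin s (Iio s), 1 < r := nhdsWithin_le_nhds (lt_mem_nhds hs)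
  obtain ⟨r, hr, hr1, hrs⟩ := (hnear.and (hgt.and self_mem_nhdsWithin)).exists
  exact ⟨r, hr1, hrs, hr⟩

lemma maximalStrongType {s : ℝ} (hs : 1 < s) (hτ : ∀ i, -(1 / 2) < τ i)
    (hτs : ∀ i, τ i < s * κ i + (s - 1) / 2) :
    MaximalStrongType (measure κ) (measure τ) s := by
  obtain ⟨r, hr, hrs, hτr⟩ := exists_exponent_lt hs hτs
  obtain ⟨D, hD⟩ := exists_hasDoublingBalls hτ
  have hw := (isMuckenhoupt_density hr hτ hτr).maximalStrongType hr hrs (D := D)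
    (by rwa [withDensity_density_sub]) (by fun_prop) (ae_density_ne_zero_and_ne_top _ _)
  rwa [withDensity_density_sub] at hw

lemma exists_exponent_gt {p Q : ℝ} (hp : 1 < p) (hQ : 1 < Q)
    (hτ : ∀ i, τ i < p * κ i + (p - 1) / 2) :
    ∃ q, 1 < q ∧ q < Q ∧ q < p ∧ ∀ i, q * τ i < p * κ i + (p - q) / 2 := by
  have hnear : ∀ᶠ q in nhdsWithin (1 : ℝ) (Ioi 1), ∀ i, q * τ i < p * κ i + (p - q) / 2 := by
    refine Filter.eventually_all.2 fun i => nhdsWithin_le_nhds ?_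
    have hleft : Continuous fun q : ℝ => q * τ i := by fun_prop
    have hright : Continuous fun q : ℝ => p * κ i + (p - q) / 2 := by fun_prop
    exact hleft.continuousAt.eventually_lt hright.continuousAt (by simpa using hτ i)
  have hlt : ∀ᶠ q in nhdsWithin (1 : ℝ) (Ioi 1), q < min Q p :=
    nhdsWithin_le_nhds (gt_mem_nhds (lt_min hQ hp))
  obtain ⟨q, hq, hqQp, hq1⟩ := (hnear.and (hlt.and self_mem_nhdsWithin)).exists
  exact ⟨q, hq1, hqQp.trans_le (min_le_left _ _), hqQp.trans_le (min_le_right _ _), hq⟩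

lemma maximalStrongType_dual {p q s : ℝ} (hq : 1 < q) (hqp : q < p)
    (hs : (p / q).HolderConjugate s) (hτ : ∀ i, -(1 / 2) < τ i)
    (hτq : ∀ i, q * τ i < p * κ i + (p - q) / 2) :
    MaximalStrongType (measure κ) (measure (κ + (1 - s) • (τ - κ))) s := by
  have hpq : 0 < p - q := by linarith
  have hs_eq : s = p / (p - q) := by
    rw [hs.conjugate_eq]; field_simp
  have hexp : ∀ i, (κ + (1 - s) • (τ - κ)) i = (p * κ i - q * τ i) / (p - q) := fun i => by
    simp only [Pi.add_apply, Pi.smul_apply, Pi.sub_apply, smul_eq_mul, hs_eq]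
    field_simp
    ring
  refine maximalStrongType hs.symm.lt (fun i => ?_) fun i => ?_
  · rw [hexp, lt_div_iff₀ hpq]
    linarith [hτq i]
  · rw [hexp, hs_eq, div_lt_iff₀ hpq]
    field_simp
    nlinarith [hτ i]

theorem maximalVectorStrongType {ι : Type*} [Countable ι] {p Q : ℝ} (hp : 1 < p) (hQ : 1 < Q)
    (hκ : ∀ i, -(1 / 2) < κ i) (hτ : ∀ i, -(1 / 2) < τ i)
    (hτp : ∀ i, τ i < p * κ i + (p - 1) / 2) :
    MaximalVectorStrongType ι (measure κ) (measure τ) p Q := by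
  obtain ⟨q, hq1, hqQ, hqp, hτq⟩ := exists_exponent_gt hp hQ hτp
  have hconj : (p / q).HolderConjugate (p / q).conjExponent :=
    .conjExponent ((one_lt_div (by linarith)).2 hqp)
  obtain ⟨D, hD⟩ := exists_hasDoublingBalls hκ
  have hfin : IsFiniteMeasure ((measure κ).withDensity fun x => density (τ - κ) x.1) := by
    rw [withDensity_density_sub]; exact isFiniteMeasure_measure hτ
  have hsmall := hD.maximalVectorStrongType_of_dual (ι := ι) (measurable_density_val (τ - κ))
    (ae_density_ne_zero_and_ne_top _ _) hq1 hconj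
    (by rw [withDensity_density_rpow]; exact maximalStrongType_dual hq1 hqp hconj hτ hτq)
  rw [withDensity_density_sub] at hsmall
  exact hsmall.of_lt (maximalStrongType hp hτ hτp) (measure_absolutelyContinuous κ τ)
    (by linarith) (by linarith) hqQ

end Muckenhoupt

end FoldedSphere

section IntertwiningMeasure

variable {k : ℝ}

lemma intertwiningDensity_eq {t : ℝ} (ht : t ∈ Ioo (-1) 1) :
    (1 + t) * (1 - t ^ 2) ^ (k - 1) = (1 + t) ^ k * (1 - t) ^ (k - 1) := by
  have ht0 : 0 < 1 + t := by linarith [ht.1]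
  rw [show 1 - t ^ 2 = (1 + t) * (1 - t) by ring, Real.mul_rpow ht0.le (by linarith [ht.2]),
    ← mul_assoc, Real.rpow_sub_one ht0.ne', mul_div_cancel₀ _ ht0.ne']

lemma setLIntegral_one_sub_rpow {δ : ℝ} (hk : 0 < k) (hδ : 0 ≤ δ) :
    ∫⁻ t in Ioo (1 - δ) 1, ENNReal.ofReal ((1 - t) ^ (k - 1)) = ENNReal.ofReal (δ ^ k / k) := by
  have hreflect := (Measure.measurePreserving_sub_left volume (1 : ℝ)).setLIntegral_comp_preimage
    (measurableSet_Ioo (a := 0) (b := δ)) (f := fun t => ENNReal.ofReal (t ^ (k - 1))) (by fun_prop)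
  rwa [lintegral_Ioo_rpow hδ hk, preimage_const_sub_Ioo, sub_zero] at hreflect

lemma intertwiningDensityMeasure_apply (k : ℝ) {s : Set ℝ} (hs : MeasurableSet s) :
    intertwiningDensityMeasure k s = ∫⁻ t in s ∩ Ioo (-1) 1,
      ENNReal.ofReal ((1 + t) ^ k * (1 - t) ^ (k - 1)) := by
  rw [intertwiningDensityMeasure, withDensity_apply _ hs, Measure.restrict_restrict hs,
    setLIntegral_congr ((Filter.EventuallyEq.refl _ s).inter Ioo_ae_eq_Icc.symm)]
  exact setLIntegral_congr_fun (hs.inter measurableSet_Ioo) fun t ht => by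
    rw [intertwiningDensity_eq ht.2]

lemma intertwiningDensityMeasure_Ici_le {δ : ℝ} (hk : 0 < k) (hδ : 0 ≤ δ) :
    intertwiningDensityMeasure k (Ici (1 - δ)) ≤ ENNReal.ofReal (2 ^ k / k * δ ^ k) := by
  rw [intertwiningDensityMeasure_apply k measurableSet_Ici]
  calc ∫⁻ t in Ici (1 - δ) ∩ Ioo (-1) 1, ENNReal.ofReal ((1 + t) ^ k * (1 - t) ^ (k - 1))
      ≤ ∫⁻ t in Ici (1 - δ) ∩ Ioo (-1) 1,
          ENNReal.ofReal (2 ^ k) * ENNReal.ofReal ((1 - t) ^ (k - 1)) := by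
        refine setLIntegral_mono' (measurableSet_Ici.inter measurableSet_Ioo) fun t ht => ?_
        have hleft : 0 ≤ 1 + t := by linarith [ht.2.1]
        have hright : 0 ≤ 1 - t := by linarith [ht.2.2]
        rw [← ENNReal.ofReal_mul (by positivity)]
        gcongr
        linarith
    _ ≤ ∫⁻ t in Icc (1 - δ) 1, ENNReal.ofReal (2 ^ k) * ENNReal.ofReal ((1 - t) ^ (k - 1)) :=
        lintegral_mono_set fun t ht => ⟨ht.1, ht.2.2.le⟩
    _ = ENNReal.ofReal (2 ^ k / k * δ ^ k) := by
        rw [← Measure.restrict_congr_set (Ioo_ae_eq_Icc (a := 1 - δ) (b := (1 : ℝ))),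
          lintegral_const_mul' _ _ ENNReal.ofReal_ne_top, setLIntegral_one_sub_rpow hk hδ,
          ← ENNReal.ofReal_mul (by positivity), mul_div_left_comm, mul_comm]

lemma intertwiningDensityMeasure_Iic_le {s : ℝ} (hk : 0 < k) (hs : s ≤ 0) :
    intertwiningDensityMeasure k (Iic s) ≤ ENNReal.ofReal (2 ^ k * (1 + s) ^ k) := by
  rw [intertwiningDensityMeasure_apply k measurableSet_Iic]
  calc ∫⁻ t in Iic s ∩ Ioo (-1) 1, ENNReal.ofReal ((1 + t) ^ k * (1 - t) ^ (k - 1))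
      ≤ ∫⁻ t in Iic s ∩ Ioo (-1) 1, ENNReal.ofReal (2 ^ k * (1 + s) ^ k) := by
        refine setLIntegral_mono' (measurableSet_Iic.inter measurableSet_Ioo) fun t ht => ?_
        have hts : t ≤ s := ht.1
        have hleft : 0 ≤ 1 + t := by linarith [ht.2.1]
        have hright : (1 - t) ^ (k - 1) ≤ 2 ^ k :=
          (Real.rpow_le_rpow_of_exponent_le (by linarith) (by linarith)).trans
            (Real.rpow_le_rpow (by linarith) (by linarith) hk.le)
        have hright0 : 0 ≤ (1 - t) ^ (k - 1) := Real.rpow_nonneg (by linarith) _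
        have hs0 : 0 ≤ 1 + s := by linarith
        rw [mul_comm (2 ^ k)]
        gcongr
    _ ≤ ∫⁻ t in Ioc (-1 : ℝ) 0, ENNReal.ofReal (2 ^ k * (1 + s) ^ k) :=
        lintegral_mono_set fun t ht => ⟨ht.2.1, le_trans ht.1 hs⟩
    _ = _ := by simp

lemma exists_intertwiningDensityMeasure_le (hk : 0 < k) :
    ∃ C : ℝ≥0, ∀ δ : ℝ, 0 < δ →
      intertwiningDensityMeasure k {t | 1 - |t| ≤ δ} ≤ C * ENNReal.ofReal (δ ^ k) := by
  refine ⟨(2 ^ k / k).toNNReal + (2 ^ k : ℝ).toNNReal, fun δ hδ => ?_⟩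
  have hsub : {t : ℝ | 1 - |t| ≤ δ} ⊆ Ici (1 - δ) ∪ Iic (min 0 (δ - 1)) := by
    intro t (ht : 1 - |t| ≤ δ)
    rcases le_total 0 t with h0 | h0
    · exact .inl (sub_le_comm.1 (abs_of_nonneg h0 ▸ ht))
    · rw [abs_of_nonpos h0] at ht
      exact .inr (le_min h0 (by linarith))
  have hmin : 0 ≤ 1 + min 0 (δ - 1) := by
    rw [← min_add_add_left]; exact le_min (by simp) (by linarith)
  calc intertwiningDensityMeasure k {t | 1 - |t| ≤ δ}
      ≤ ENNReal.ofReal (2 ^ k / k * δ ^ k) + ENNReal.ofReal (2 ^ k * (1 + min 0 (δ - 1)) ^ k) :=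
        (measure_mono hsub).trans <| (measure_union_le _ _).trans <|
          add_le_add (intertwiningDensityMeasure_Ici_le hk hδ.le)
            (intertwiningDensityMeasure_Iic_le hk (min_le_left _ _))
    _ ≤ ENNReal.ofReal (2 ^ k / k * δ ^ k) + ENNReal.ofReal (2 ^ k * δ ^ k) := by
        gcongr; linarith [min_le_right 0 (δ - 1)]
    _ = _ := by
        rw [ENNReal.ofReal_mul (by positivity), ENNReal.ofReal_mul (by positivity), ← add_mul]
        rfl

lemma le_intertwiningDensityMeasure_Icc {δ : ℝ} (hk : 0 < k) (hδ : 0 ≤ δ) (hδ1 : δ ≤ 1) :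
    ENNReal.ofReal (δ ^ k / k) ≤ intertwiningDensityMeasure k (Icc (1 - δ) 1) := by
  rw [intertwiningDensityMeasure_apply k measurableSet_Icc, ← setLIntegral_one_sub_rpow hk hδ]
  calc ∫⁻ t in Ioo (1 - δ) 1, ENNReal.ofReal ((1 - t) ^ (k - 1))
      ≤ ∫⁻ t in Ioo (1 - δ) 1, ENNReal.ofReal ((1 + t) ^ k * (1 - t) ^ (k - 1)) := by
        refine setLIntegral_mono' measurableSet_Ioo fun t ht => ?_
        have hright : 0 ≤ 1 - t := by linarith [ht.2]
        gcongr
        exact le_mul_of_one_le_left (by positivity) (Real.one_le_rpow (by linarith [ht.1]) hk.le)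
    _ ≤ _ := by
        refine lintegral_mono_set fun t ht => ?_
        exact ⟨Ioo_subset_Icc_self ht, by linarith [ht.1], ht.2⟩

lemma intertwiningDensityMeasure_univ_ne_top (hk : 0 < k) :
    intertwiningDensityMeasure k univ ≠ ∞ := by
  have hIci : univ ⊆ Iic 0 ∪ Ici (1 - 1 : ℝ) := by simp
  refine ne_top_of_le_ne_top ?_ ((measure_mono hIci).trans (measure_union_le _ _))
  exact ENNReal.add_ne_top.2
    ⟨ne_top_of_le_ne_top ENNReal.ofReal_ne_top (intertwiningDensityMeasure_Iic_le hk le_rfl),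
      ne_top_of_le_ne_top ENNReal.ofReal_ne_top (intertwiningDensityMeasure_Ici_le hk zero_le_one)⟩

lemma intertwiningDensityMeasure_univ_ne_zero (hk : 0 < k) :
    intertwiningDensityMeasure k univ ≠ 0 := by
  have hpos : 0 < ENNReal.ofReal (1 ^ k / k) := ENNReal.ofReal_pos.2 (by positivity)
  exact ((hpos.trans_le (le_intertwiningDensityMeasure_Icc hk zero_le_one le_rfl)).trans_le
    (measure_mono (subset_univ _))).ne'

lemma intertwiningMeasure_zero : intertwiningMeasure 0 = Measure.dirac 1 := if_pos rfl

lemma intertwiningMeasure_of_pos (hk : 0 < k) :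
    intertwiningMeasure k =
      (intertwiningDensityMeasure k univ)⁻¹ • intertwiningDensityMeasure k := if_neg hk.ne'

lemma isProbabilityMeasure_intertwiningMeasure (hk : 0 ≤ k) :
    IsProbabilityMeasure (intertwiningMeasure k) := by
  rcases hk.eq_or_lt with rfl | hk
  · rw [intertwiningMeasure_zero]; infer_instance
  · rw [intertwiningMeasure_of_pos hk]
    exact ⟨ENNReal.inv_mul_cancel (intertwiningDensityMeasure_univ_ne_zero hk)
      (intertwiningDensityMeasure_univ_ne_top hk)⟩

lemma ae_abs_le_one_intertwiningMeasure (hk : 0 ≤ k) :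
    ∀ᵐ t ∂(intertwiningMeasure k), |t| ≤ 1 := by
  rcases hk.eq_or_lt with rfl | hk
  · rw [intertwiningMeasure_zero, ae_dirac_iff (measurableSet_le (by fun_prop) (by fun_prop))]
    simp
  · rw [intertwiningMeasure_of_pos hk]
    refine Measure.smul_absolutelyContinuous.ae_le
      ((withDensity_absolutelyContinuous _ _).ae_le ?_)
    filter_upwards [ae_restrict_mem measurableSet_Icc] with t ht using abs_le.2 ht

lemma exists_intertwiningMeasure_le (hk : 0 ≤ k) :
    ∃ C : ℝ≥0, ∀ δ : ℝ, 0 < δ →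
      intertwiningMeasure k {t | 1 - |t| ≤ δ} ≤ C * ENNReal.ofReal (δ ^ k) := by
  have := isProbabilityMeasure_intertwiningMeasure hk
  rcases hk.eq_or_lt with rfl | hk
  · exact ⟨1, fun δ _ => by simpa using prob_le_one⟩
  obtain ⟨C, hC⟩ := exists_intertwiningDensityMeasure_le hk
  refine ⟨(intertwiningDensityMeasure k univ)⁻¹.toNNReal * C, fun δ hδ => ?_⟩
  rw [intertwiningMeasure_of_pos hk, Measure.smul_apply, smul_eq_mul, ENNReal.coe_mul,
    ENNReal.coe_toNNReal (ENNReal.inv_ne_top.2 (intertwiningDensityMeasure_univ_ne_zero hk)),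
    mul_assoc]
  gcongr
  exact hC δ hδ

lemma exists_le_intertwiningMeasure (hk : 0 ≤ k) :
    ∃ c : ℝ≥0, 0 < c ∧ ∀ δ : ℝ, 0 < δ → δ ≤ 1 →
      c * ENNReal.ofReal (δ ^ k) ≤ intertwiningMeasure k (Icc (1 - δ) 1) := by
  rcases hk.eq_or_lt with rfl | hk
  · refine ⟨1, one_pos, fun δ hδ _ => ?_⟩
    have hmem : (1 : ℝ) ∈ Icc (1 - δ) 1 := ⟨by linarith, le_rfl⟩
    rw [intertwiningMeasure_zero, Measure.dirac_apply_of_mem hmem]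
    simp
  set m := (intertwiningDensityMeasure k univ)⁻¹
  have hm : m ≠ ∞ := ENNReal.inv_ne_top.2 (intertwiningDensityMeasure_univ_ne_zero hk)
  have hm0 : m ≠ 0 := ENNReal.inv_ne_zero.2 (intertwiningDensityMeasure_univ_ne_top hk)
  refine ⟨m.toNNReal * k⁻¹.toNNReal, mul_pos (ENNReal.toNNReal_pos hm0 hm) (by simpa), ?_⟩
  intro δ hδ hδ1
  rw [intertwiningMeasure_of_pos hk, Measure.smul_apply, smul_eq_mul, ENNReal.coe_mul,
    ENNReal.coe_toNNReal hm, mul_assoc]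
  gcongr
  refine le_of_eq_of_le ?_ (le_intertwiningDensityMeasure_Icc hk hδ.le hδ1)
  rw [div_eq_inv_mul, ENNReal.ofReal_mul (by positivity)]
  rfl

end IntertwiningMeasure

lemma prod_ofReal_mul_sq_rpow {ι : Type*} [Fintype ι] {a : ℝ} (ha : 0 ≤ a) {u : ι → ℝ}
    (hu : ∀ i, 0 ≤ u i) (κ : ι → ℝ) :
    ∏ i, ENNReal.ofReal ((a * u i ^ 2) ^ κ i) =
      ENNReal.ofReal (∏ i, a ^ κ i) * ENNReal.ofReal (∏ i, u i ^ (2 * κ i)) := by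
  have hu' : ∀ i, 0 ≤ u i ^ (2 * κ i) := fun i => Real.rpow_nonneg (hu i) _
  rw [← ENNReal.ofReal_mul (by positivity), ← Finset.prod_mul_distrib,
    ENNReal.ofReal_prod_of_nonneg fun i _ => mul_nonneg (by positivity) (hu' i)]
  refine Finset.prod_congr rfl fun i _ => ?_
  rw [Real.mul_rpow ha (by positivity), Real.rpow_mul (hu i), Real.rpow_two]

lemma le_mul_div_sq_of_mul_mul_le {a b u θ : ℝ} (ha : 0 ≤ a) (hθ : 0 < θ)
    (hab : |b - a| ≤ θ) (hu : u ≤ 1) (habu : a * b * u ≤ θ ^ 2 / 2) :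
    u ≤ 25 * (θ / (a + θ)) ^ 2 := by
  rw [div_pow, mul_div_assoc', le_div_iff₀ (by positivity)]
  rcases lt_or_ge a (4 * θ) with ha4 | ha4
  · calc u * (a + θ) ^ 2 ≤ 1 * (5 * θ) ^ 2 := by gcongr; linarith
      _ = 25 * θ ^ 2 := by ring
  · have hb : 3 / 4 * a ≤ b := by linarith [neg_le_of_abs_le hab]
    rcases le_or_gt u 0 with hu0 | hu0
    · exact (mul_nonpos_of_nonpos_of_nonneg hu0 (by positivity)).trans (by positivity)
    · calc u * (a + θ) ^ 2 ≤ u * (5 / 4 * a) ^ 2 := by gcongr; linarith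
        _ = 25 / 12 * (a * (3 / 4 * a) * u) := by ring
        _ ≤ 25 / 12 * (a * b * u) := by gcongr
        _ ≤ 25 * θ ^ 2 := by nlinarith

lemma cos_le_one_sub_sq_div_five {θ : ℝ} (hθ : |θ| ≤ Real.pi) : Real.cos θ ≤ 1 - θ ^ 2 / 5 := by
  have hpi : 1 / 5 ≤ 2 / Real.pi ^ 2 := by
    rw [div_le_div_iff₀ (by norm_num) (by positivity)]
    nlinarith [Real.pi_lt_d2, Real.pi_pos]
  nlinarith [Real.cos_le_one_sub_mul_cos_sq hθ, mul_le_mul_of_nonneg_right hpi (sq_nonneg θ)]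

namespace FoldedSphere

variable {d : ℕ}

section CapFactors

variable {x y : FoldedSphere d} {θ : ℝ} {t : Fin (d + 1) → ℝ}

lemma sum_sq_coord (x : FoldedSphere d) : ∑ i, x.1 i ^ 2 = 1 := by
  rw [← EuclideanSpace.real_norm_sq_eq, norm_eq_one, one_pow]

lemma sum_sq_abs_sub_abs (x y : FoldedSphere d) :
    ∑ i, (|x.1 i| - |y.1 i|) ^ 2 = 2 - 2 * ∑ i, |x.1 i * y.1 i| := by
  simp only [sub_sq, sq_abs, mul_assoc, ← abs_mul, Finset.sum_sub_distrib, Finset.sum_add_distrib,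
    ← Finset.mul_sum, sum_sq_coord]
  ring

lemma sum_abs_mul_le_one (x y : FoldedSphere d) : ∑ i, |x.1 i * y.1 i| ≤ 1 := by
  have hnonneg : 0 ≤ ∑ i, (|x.1 i| - |y.1 i|) ^ 2 := Finset.sum_nonneg fun i _ => sq_nonneg _
  linarith [sum_sq_abs_sub_abs x y]

lemma sq_abs_sub_abs_le (x y : FoldedSphere d) (i : Fin (d + 1)) :
    (|y.1 i| - |x.1 i|) ^ 2 ≤ 2 - 2 * ∑ i, |x.1 i * y.1 i| := by
  rw [← sum_sq_abs_sub_abs, sub_sq_comm]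
  exact Finset.single_le_sum (f := fun i => (|x.1 i| - |y.1 i|) ^ 2) (fun i _ => sq_nonneg _)
    (Finset.mem_univ i)

lemma measurableSet_solidCap (x : EuclideanSpace ℝ (Fin (d + 1))) (θ : ℝ) :
    MeasurableSet (solidCap x θ) := by
  rw [solidCap, ofPred_and]
  exact (measurableSet_le (by fun_prop) (by fun_prop)).inter
    (measurableSet_le (by fun_prop) (by fun_prop))

/-- The vectors `t` whose coordinatewise product with `y` lies in the solid cap `B(x,θ)`; their
measure is `V_κ[χ_{B(x,θ)}](y)`. -/
def capFactors (x y : FoldedSphere d) (θ : ℝ) : Set (Fin (d + 1) → ℝ) :=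
  {t | (WithLp.toLp 2 fun i => y.1 i * t i) ∈ solidCap x.1 θ}

lemma intertwiningOp_indicator (κ : Fin (d + 1) → ℝ) (x y : FoldedSphere d) (θ : ℝ) :
    intertwiningOp κ ((solidCap x.1 θ).indicator 1) y.1 =
      Measure.pi (fun i => intertwiningMeasure (κ i)) (capFactors x y θ) :=
  lintegral_indicator_one ((measurableSet_solidCap x.1 θ).preimage (by fun_prop))

lemma mem_capFactors_iff :
    t ∈ capFactors x y θ ↔
      ∑ i, (y.1 i * t i) ^ 2 ≤ 1 ∧ Real.cos θ ≤ ∑ i, x.1 i * y.1 i * t i := by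
  simp only [capFactors, solidCap, mem_ofPred_eq, ← sq_le_one_iff₀ (norm_nonneg _),
    EuclideanSpace.real_norm_sq_eq, PiLp.inner_apply, RCLike.inner_apply, conj_trivial,
    mul_right_comm, mul_comm (x.1 _)]

lemma one_sub_sq_div_two_le_sum (ht : t ∈ capFactors x y θ) :
    1 - θ ^ 2 / 2 ≤ ∑ i, |x.1 i * y.1 i| * |t i| :=
  calc 1 - θ ^ 2 / 2 ≤ Real.cos θ := Real.one_sub_sq_div_two_le_cos
    _ ≤ ∑ i, x.1 i * y.1 i * t i := (mem_capFactors_iff.1 ht).2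
    _ ≤ ∑ i, |x.1 i * y.1 i| * |t i| :=
        Finset.sum_le_sum fun _ _ => (le_abs_self _).trans (abs_mul _ _).le

lemma abs_abs_sub_abs_le_of_mem_capFactors (ht : t ∈ capFactors x y θ) (ht1 : ∀ i, |t i| ≤ 1)
    (i : Fin (d + 1)) : abs (|y.1 i| - |x.1 i|) ≤ |θ| := by
  have hsum : ∑ i, |x.1 i * y.1 i| * |t i| ≤ ∑ i, |x.1 i * y.1 i| :=
    Finset.sum_le_sum fun i _ => mul_le_of_le_one_right (abs_nonneg _) (ht1 i)
  refine sq_le_sq.1 ((sq_abs_sub_abs_le x y i).trans ?_)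
  linarith [one_sub_sq_div_two_le_sum ht]

lemma abs_mul_mul_one_sub_le_of_mem_capFactors (ht : t ∈ capFactors x y θ)
    (ht1 : ∀ i, |t i| ≤ 1) (i : Fin (d + 1)) :
    |x.1 i * y.1 i| * (1 - |t i|) ≤ θ ^ 2 / 2 :=
  calc |x.1 i * y.1 i| * (1 - |t i|) ≤ ∑ i, |x.1 i * y.1 i| * (1 - |t i|) :=
        Finset.single_le_sum (f := fun i => |x.1 i * y.1 i| * (1 - |t i|))
          (fun i _ => mul_nonneg (abs_nonneg _) (sub_nonneg.2 (ht1 i))) (Finset.mem_univ i)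
    _ = ∑ i, |x.1 i * y.1 i| - ∑ i, |x.1 i * y.1 i| * |t i| := by
        simp only [mul_sub, mul_one, Finset.sum_sub_distrib]
    _ ≤ θ ^ 2 / 2 := by linarith [sum_abs_mul_le_one x y, one_sub_sq_div_two_le_sum ht]

lemma one_sub_abs_le_of_mem_capFactors (hθ : 0 < θ) (ht : t ∈ capFactors x y θ)
    (ht1 : ∀ i, |t i| ≤ 1) (i : Fin (d + 1)) :
    1 - |t i| ≤ 25 * (θ / (|x.1 i| + θ)) ^ 2 :=
  le_mul_div_sq_of_mul_mul_le (abs_nonneg _) hθ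
    ((abs_abs_sub_abs_le_of_mem_capFactors ht ht1 i).trans_eq (abs_of_pos hθ))
    (by linarith [abs_nonneg (t i)])
    (by simpa only [abs_mul] using abs_mul_mul_one_sub_le_of_mem_capFactors ht ht1 i)

lemma one_sub_sq_div_le_sum_mul (hy : y ∈ signedBall x (θ / (4 * (d + 1)))) :
    1 - θ ^ 2 / 32 ≤ ∑ i, x.1 i * y.1 i := by
  have habs : ∑ i, |x.1 i * y.1 i| = ∑ i, x.1 i * y.1 i :=
    Finset.sum_congr rfl fun i _ => abs_of_nonneg (hy i).2
  have hdist : ∑ i, (|x.1 i| - |y.1 i|) ^ 2 ≤ θ ^ 2 / 16 :=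
    calc ∑ i, (|x.1 i| - |y.1 i|) ^ 2 ≤ ∑ _ : Fin (d + 1), (θ / (4 * (d + 1))) ^ 2 := by
          refine Finset.sum_le_sum fun i _ => ?_
          rw [← sq_abs, abs_sub_comm]
          gcongr
          exact (hy i).1.le
      _ = θ ^ 2 / 16 / (d + 1) := by
          rw [Finset.sum_const, Finset.card_univ, Fintype.card_fin, nsmul_eq_mul]
          push_cast
          field_simp
          norm_num
      _ ≤ θ ^ 2 / 16 := div_le_self (by positivity) (by linarith [Nat.cast_nonneg (α := ℝ) d])
  linarith [sum_sq_abs_sub_abs x y]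

lemma mul_mul_one_sub_le (hθ : 0 < θ) (hy : y ∈ signedBall x (θ / (4 * (d + 1)))) {a s : ℝ}
    (ha : 0 ≤ a) {i : Fin (d + 1)} (hs : 1 - a * (θ / (|x.1 i| + θ)) ^ 2 ≤ s) :
    x.1 i * y.1 i * (1 - s) ≤ a * θ ^ 2 := by
  have hy_le : |y.1 i| ≤ |x.1 i| + θ := by
    have hθ_le : θ / (4 * (d + 1)) ≤ θ :=
      div_le_self hθ.le (by linarith [Nat.cast_nonneg (α := ℝ) d])
    linarith [(abs_lt.1 (hy i).1).2]
  calc x.1 i * y.1 i * (1 - s) ≤ |x.1 i| * |y.1 i| * (a * (θ / (|x.1 i| + θ)) ^ 2) := by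
        rw [← abs_mul, abs_of_nonneg (hy i).2]
        exact mul_le_mul_of_nonneg_left (by linarith) (hy i).2
    _ ≤ (|x.1 i| + θ) * (|x.1 i| + θ) * (a * (θ / (|x.1 i| + θ)) ^ 2) := by
        gcongr
        linarith
    _ = a * θ ^ 2 := by field_simp

lemma mul_div_sq_le_one (x : FoldedSphere d) (hθ : 0 < θ) (i : Fin (d + 1)) :
    (10 * (d + 1) : ℝ)⁻¹ * (θ / (|x.1 i| + θ)) ^ 2 ≤ 1 := by
  refine mul_le_one₀ (inv_le_one_of_one_le₀ (by linarith [Nat.cast_nonneg (α := ℝ) d]))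
    (by positivity) (pow_le_one₀ (by positivity) ?_)
  rw [div_le_one (by positivity)]
  linarith [abs_nonneg (x.1 i)]

lemma pi_Icc_subset_capFactors (hθ : 0 < θ) (hθπ : θ ≤ Real.pi)
    (hy : y ∈ signedBall x (θ / (4 * (d + 1)))) :
    univ.pi (fun i => Icc (1 - (10 * (d + 1) : ℝ)⁻¹ * (θ / (|x.1 i| + θ)) ^ 2) 1) ⊆
      capFactors x y θ := by
  intro t ht
  refine mem_capFactors_iff.2 ⟨?_, ?_⟩
  · refine (Finset.sum_le_sum fun i _ => ?_).trans (sum_sq_coord y).le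
    obtain ⟨hlow, hup⟩ := ht i (mem_univ i)
    rw [mul_pow]
    exact mul_le_of_le_one_right (sq_nonneg _)
      (pow_le_one₀ (by linarith [mul_div_sq_le_one x hθ i]) hup)
  · have hdefect : ∑ i, x.1 i * y.1 i * (1 - t i) ≤ θ ^ 2 / 10 :=
      calc ∑ i, x.1 i * y.1 i * (1 - t i) ≤
            ∑ _ : Fin (d + 1), (10 * (d + 1) : ℝ)⁻¹ * θ ^ 2 :=
            Finset.sum_le_sum fun i _ =>
              mul_mul_one_sub_le hθ hy (by positivity) (ht i (mem_univ i)).1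
        _ = θ ^ 2 / 10 := by
            rw [Finset.sum_const, Finset.card_univ, Fintype.card_fin, nsmul_eq_mul]
            push_cast
            field_simp
    simp only [mul_sub, mul_one, Finset.sum_sub_distrib] at hdefect
    linarith [one_sub_sq_div_le_sum_mul hy, sq_nonneg θ,
      cos_le_one_sub_sq_div_five (by rwa [abs_of_pos hθ])]

end CapFactors

section KernelBounds

variable {κ : Fin (d + 1) → ℝ}

/-- The order of magnitude of `V_κ[χ_{B(x,θ)}]` near `x`. -/
def kernelSize (κ : Fin (d + 1) → ℝ) (x : FoldedSphere d) (θ : ℝ) : ℝ≥0∞ :=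
  ENNReal.ofReal (∏ i, (θ / (|x.1 i| + θ)) ^ (2 * κ i))

lemma ae_abs_le_one_pi_intertwiningMeasure (hκ : ∀ i, 0 ≤ κ i) :
    ∀ᵐ t ∂(Measure.pi fun i => intertwiningMeasure (κ i)), ∀ i, |t i| ≤ 1 := by
  have := fun i => isProbabilityMeasure_intertwiningMeasure (hκ i)
  refine ae_all_iff.2 fun i => ?_
  exact (Measure.tendsto_eval_ae_ae (μ := fun i => intertwiningMeasure (κ i))).eventually
    (ae_abs_le_one_intertwiningMeasure (hκ i))

lemma intertwiningOp_eq_zero (hκ : ∀ i, 0 ≤ κ i) {x y : FoldedSphere d} {θ : ℝ} (hθ : 0 < θ)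
    (hy : y ∉ ball x (2 * θ)) : intertwiningOp κ ((solidCap x.1 θ).indicator 1) y.1 = 0 := by
  rw [intertwiningOp_indicator, measure_eq_zero_iff_ae_notMem]
  filter_upwards [ae_abs_le_one_pi_intertwiningMeasure hκ] with t ht hmem
  refine hy ((mem_ball_iff (by positivity)).2 fun i => ?_)
  have hle := abs_abs_sub_abs_le_of_mem_capFactors hmem ht i
  rw [abs_of_pos hθ] at hle
  linarith

lemma exists_intertwiningOp_le (hκ : ∀ i, 0 ≤ κ i) :
    ∃ C : ℝ≥0, ∀ (x y : FoldedSphere d) (θ : ℝ), 0 < θ →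
      intertwiningOp κ ((solidCap x.1 θ).indicator 1) y.1 ≤ C * kernelSize κ x θ := by
  have := fun i => isProbabilityMeasure_intertwiningMeasure (hκ i)
  choose C hC using fun i => exists_intertwiningMeasure_le (hκ i)
  refine ⟨(∏ i, C i) * (∏ i, (25 : ℝ) ^ κ i).toNNReal, fun x y θ hθ => ?_⟩
  rw [intertwiningOp_indicator]
  calc Measure.pi (fun i => intertwiningMeasure (κ i)) (capFactors x y θ)
      ≤ Measure.pi (fun i => intertwiningMeasure (κ i))
          (univ.pi fun i => {t | 1 - |t| ≤ 25 * (θ / (|x.1 i| + θ)) ^ 2}) := by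
        refine measure_mono_ae ?_
        filter_upwards [ae_abs_le_one_pi_intertwiningMeasure hκ] with t ht hmem
        exact fun i _ => one_sub_abs_le_of_mem_capFactors hθ hmem ht i
    _ = ∏ i, intertwiningMeasure (κ i) {t | 1 - |t| ≤ 25 * (θ / (|x.1 i| + θ)) ^ 2} :=
        Measure.pi_pi _ _
    _ ≤ ∏ i, C i * ENNReal.ofReal ((25 * (θ / (|x.1 i| + θ)) ^ 2) ^ κ i) :=
        Finset.prod_le_prod' fun i _ => hC i _ (by positivity)
    _ = _ := by
        rw [Finset.prod_mul_distrib,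
          prod_ofReal_mul_sq_rpow (by norm_num) (fun i => by positivity) κ, ← kernelSize,
          ENNReal.coe_mul, ENNReal.ofNNReal_finsetProd, mul_assoc]
        rfl

lemma exists_le_intertwiningOp (hκ : ∀ i, 0 ≤ κ i) :
    ∃ c : ℝ≥0, 0 < c ∧ ∀ (x y : FoldedSphere d) (θ : ℝ), 0 < θ → θ ≤ Real.pi →
      y ∈ signedBall x (θ / (4 * (d + 1))) →
      c * kernelSize κ x θ ≤ intertwiningOp κ ((solidCap x.1 θ).indicator 1) y.1 := by
  have := fun i => isProbabilityMeasure_intertwiningMeasure (hκ i)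
  choose c hc0 hc using fun i => exists_le_intertwiningMeasure (hκ i)
  refine ⟨(∏ i, c i) * (∏ i, ((10 * (d + 1) : ℝ)⁻¹) ^ κ i).toNNReal,
    mul_pos (Finset.prod_pos fun i _ => hc0 i)
      (Real.toNNReal_pos.2 (Finset.prod_pos fun i _ => by positivity)),
    fun x y θ hθ hθπ hy => ?_⟩
  set δ : Fin (d + 1) → ℝ := fun i => (10 * (d + 1) : ℝ)⁻¹ * (θ / (|x.1 i| + θ)) ^ 2
  rw [intertwiningOp_indicator]
  calc _ = ∏ i, c i * ENNReal.ofReal (δ i ^ κ i) := by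
        rw [Finset.prod_mul_distrib,
          prod_ofReal_mul_sq_rpow (by positivity) (fun i => by positivity) κ, ← kernelSize,
          ENNReal.coe_mul, ENNReal.ofNNReal_finsetProd, mul_assoc]
        rfl
    _ ≤ ∏ i, intertwiningMeasure (κ i) (Icc (1 - δ i) 1) :=
        Finset.prod_le_prod' fun i _ => hc i (δ i) (by positivity) (mul_div_sq_le_one x hθ i)
    _ = Measure.pi (fun i => intertwiningMeasure (κ i)) (univ.pi fun i => Icc (1 - δ i) 1) :=
        (Measure.pi_pi _ _).symm
    _ ≤ Measure.pi (fun i => intertwiningMeasure (κ i)) (capFactors x y θ) :=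
        measure_mono (pi_Icc_subset_capFactors hθ hθπ hy)

lemma exists_lintegral_mul_intertwiningOp_le (hκ : ∀ i, 0 ≤ κ i) :
    ∃ C : ℝ≥0, ∀ (g : FoldedSphere d → ℝ≥0∞) (x : FoldedSphere d) (θ : ℝ), 0 < θ →
      ∫⁻ y, g y * intertwiningOp κ ((solidCap x.1 θ).indicator 1) y.1 ∂(measure κ) ≤
        C * kernelSize κ x θ * ∫⁻ y in ball x (2 * θ), g y ∂(measure κ) := by
  obtain ⟨C, hC⟩ := exists_intertwiningOp_le hκ
  refine ⟨C, fun g x θ hθ => ?_⟩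
  have hsize : C * kernelSize κ x θ ≠ ∞ :=
    ENNReal.mul_ne_top ENNReal.coe_ne_top ENNReal.ofReal_ne_top
  rw [← lintegral_const_mul' _ _ hsize, ← lintegral_indicator measurableSet_ball]
  refine lintegral_mono fun y => ?_
  by_cases hy : y ∈ ball x (2 * θ)
  · rw [indicator_of_mem hy, mul_comm]
    gcongr
    exact hC x y θ hθ
  · simp only [intertwiningOp_eq_zero hκ hθ hy, mul_zero, zero_le]

lemma exists_le_lintegral_intertwiningOp (hκ : ∀ i, 0 ≤ κ i) :
    ∃ c : ℝ≥0, 0 < c ∧ ∀ (x : FoldedSphere d) (θ : ℝ), 0 < θ → θ ≤ Real.pi →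
      c * kernelSize κ x θ * measure κ (signedBall x (θ / (4 * (d + 1)))) ≤
        ∫⁻ y : FoldedSphere d, intertwiningOp κ ((solidCap x.1 θ).indicator 1) y.1
          ∂(measure κ) := by
  obtain ⟨c, hc0, hc⟩ := exists_le_intertwiningOp hκ
  refine ⟨c, hc0, fun x θ hθ hθπ => ?_⟩
  have hmeas : MeasurableSet (signedBall x (θ / (4 * (d + 1)))) :=
    show MeasurableSet {y : UnitSphere d | y.1 ∈ signedNearSet x (θ / (4 * (d + 1)))} from
      measurable_subtype_coe (measurableSet_signedNearSet x _)
  rw [← setLIntegral_const]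
  exact (setLIntegral_mono' hmeas fun y hy => hc x y θ hθ hθπ hy).trans
    (setLIntegral_le_lintegral _ _)

lemma exists_setLIntegral_ball_le (hκ : ∀ i, -(1 / 2) < κ i) :
    ∃ K : ℝ≥0, ∀ (g : FoldedSphere d → ℝ≥0∞) (x : FoldedSphere d) (θ : ℝ), 0 < θ →
      θ ≤ Real.pi → ∫⁻ y in ball x (2 * θ), g y ∂(measure κ) ≤
        K * maximalFunction (measure κ) g x * measure κ (signedBall x (θ / (4 * (d + 1)))) := by
  obtain ⟨D, hD⟩ := exists_hasDoublingBalls hκ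
  obtain ⟨K, hK⟩ := exists_measure_ball_mul_le hκ (l := 8 * (d + 1))
    (by linarith [Nat.cast_nonneg (α := ℝ) d]) (2 * Real.pi)
  refine ⟨K, fun g x θ hθ hθπ => ?_⟩
  have hscale : 8 * (d + 1) * (θ / (4 * (d + 1))) = 2 * θ := by field_simp; norm_num
  have hball : measure κ (ball x (2 * θ)) ≤
      K * measure κ (signedBall x (θ / (4 * (d + 1)))) := by
    rw [← hscale]
    exact hK x _ (by positivity) (by rw [hscale]; linarith)
  calc ∫⁻ y in ball x (2 * θ), g y ∂(measure κ)
      ≤ maximalFunction (measure κ) g x * measure κ (ball x (2 * θ)) := by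
        rw [← ENNReal.div_le_iff_le_mul (.inl (hD.ball_pos x _ (by positivity)).ne')
          (.inl (hD.ball_lt_top x _).ne)]
        exact le_maximalFunction (mem_ball_self (by positivity))
    _ ≤ maximalFunction (measure κ) g x *
          (K * measure κ (signedBall x (θ / (4 * (d + 1))))) := by gcongr
    _ = _ := by ring

theorem exists_intertwiningMaximal_le {𝕜 : Type*} [RCLike 𝕜] (hκ : ∀ i, 0 ≤ κ i) :
    ∃ K : ℝ≥0, ∀ (f : UnitSphere d → 𝕜) (x : FoldedSphere d),
      intertwiningMaximal κ f x ≤ K * maximalFunction (measure κ) (fun y => ‖f y‖ₑ) x := by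
  obtain ⟨C, hC⟩ := exists_lintegral_mul_intertwiningOp_le hκ
  obtain ⟨c, hc0, hc⟩ := exists_le_lintegral_intertwiningOp hκ
  obtain ⟨K, hK⟩ := exists_setLIntegral_ball_le (κ := κ) fun i => by linarith [hκ i]
  refine ⟨C / c * K, fun f x => iSup₂_le fun θ hθ => ENNReal.div_le_of_le_mul ?_⟩
  obtain ⟨hθ0, hθπ⟩ := hθ
  set M := maximalFunction (measure κ) (fun y : FoldedSphere d => ‖f y‖ₑ) x
  set Φ := kernelSize κ x θ
  set S := measure κ (signedBall x (θ / (4 * (d + 1))))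
  calc ∫⁻ y : FoldedSphere d, ‖f y‖ₑ * intertwiningOp κ ((solidCap x.1 θ).indicator 1) y.1
        ∂(measure κ)
      ≤ C * Φ * ∫⁻ y in ball x (2 * θ), ‖f y‖ₑ ∂(measure κ) := hC _ x θ hθ0
    _ ≤ C * Φ * (K * M * S) := by gcongr; exact hK _ x θ hθ0 hθπ
    _ = (C / c * K : ℝ≥0) * M * (c * Φ * S) := by
        nth_rw 1 [← div_mul_cancel₀ C hc0.ne']
        push_cast
        ring
    _ ≤ _ := by gcongr; exact hc x θ hθ0 hθπ

end KernelBounds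

section VectorValued

variable {κ τ : Fin (d + 1) → ℝ} {p q : ℝ}

lemma exists_lintegral_lqNorm_intertwiningMaximal_le_of_measurable {ι 𝕜 : Type*} [RCLike 𝕜]
    (hκ : ∀ i, 0 ≤ κ i) (hp : 0 ≤ p) (hq : 0 < q)
    (hM : MaximalVectorStrongType ι (measure κ) (measure τ) p q) :
    ∃ C : ℝ≥0, ∀ (f : ι → UnitSphere d → 𝕜) (g : ι → FoldedSphere d → ℝ≥0∞),
      (∀ j, Measurable (g j)) → (∀ j, ∀ᵐ y ∂(surface d), ‖f j y‖ₑ ≤ g j y) →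
      ∫⁻ x, lqNorm q (fun j => intertwiningMaximal κ (f j) x) ^ p ∂(weightedMeasure τ) ≤
        C * ∫⁻ x, lqNorm q (g · x) ^ p ∂(measure τ) := by
  obtain ⟨K, hK⟩ := exists_intertwiningMaximal_le (𝕜 := 𝕜) hκ
  obtain ⟨C, hC⟩ := hM
  refine ⟨K ^ p * C, fun f g hg hfg => ?_⟩
  have hpointwise : ∀ (x : FoldedSphere d) j, intertwiningMaximal κ (f j) x ≤
      K * maximalFunction (measure κ) (g j) x := fun x j =>
    (hK (f j) x).trans (mul_le_mul_right (maximalFunction_mono_ae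
      ((measure_absolutelyContinuous_surface κ).ae_le (hfg j)) x) _)
  calc ∫⁻ x : FoldedSphere d, lqNorm q (fun j => intertwiningMaximal κ (f j) x) ^ p ∂(measure τ)
      ≤ ∫⁻ x, K ^ p * lqNorm q (fun j => maximalFunction (measure κ) (g j) x) ^ p
          ∂(measure τ) := by
        refine lintegral_mono fun x => ?_
        rw [← ENNReal.mul_rpow_of_nonneg _ _ hp, ← lqNorm_const_mul hq]
        exact ENNReal.rpow_le_rpow (lqNorm_mono hq.le (hpointwise x)) hp
    _ = K ^ p * ∫⁻ x, lqNorm q (fun j => maximalFunction (measure κ) (g j) x) ^ p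
          ∂(measure τ) := lintegral_const_mul' _ _ (by finiteness)
    _ ≤ K ^ p * (C * ∫⁻ x, lqNorm q (g · x) ^ p ∂(measure τ)) := by gcongr; exact hC g hg
    _ = _ := by rw [ENNReal.coe_mul, ENNReal.coe_rpow_of_nonneg _ hp, mul_assoc]

theorem exists_lintegral_lqNorm_intertwiningMaximal_le {ι 𝕜 : Type*} [Countable ι] [RCLike 𝕜]
    (hp : 1 < p) (hq : 1 < q) (hκ : ∀ i, 0 ≤ κ i)
    (hτ : ∀ i, -(1 / 2) < τ i ∧ τ i < p * κ i + (p - 1) / 2) :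
    ∃ C : ℝ≥0, ∀ f : ι → UnitSphere d → 𝕜,
      (∀ j, AEStronglyMeasurable (f j) (surfaceMeasure d)) →
      ∫⁻ x, lqNorm q (fun j => intertwiningMaximal κ (f j) x) ^ p ∂(weightedMeasure τ) ≤
        C * ∫⁻ x, lqNorm q (fun j => ‖f j x‖ₑ) ^ p ∂(weightedMeasure τ) := by
  have hM : MaximalVectorStrongType ι (measure κ) (measure τ) p q :=
    maximalVectorStrongType hp hq (fun i => by linarith [hκ i]) (fun i => (hτ i).1)
      fun i => (hτ i).2
  obtain ⟨C, hC⟩ := exists_lintegral_lqNorm_intertwiningMaximal_le_of_measurable (𝕜 := 𝕜) hκ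
    (by linarith) (by linarith) hM
  refine ⟨C, fun f hf => ?_⟩
  have hfm : ∀ j, AEMeasurable (fun y : FoldedSphere d => ‖f j y‖ₑ) (surface d) :=
    fun j => (hf j).enorm
  refine (hC f _ (fun j => (hfm j).measurable_mk) fun j => (hfm j).ae_eq_mk.le).trans_eq ?_
  congr 1
  refine lintegral_congr_ae ((measure_absolutelyContinuous_surface τ).ae_le ?_)
  filter_upwards [ae_all_iff.2 fun j => (hfm j).ae_eq_mk] with x hx
  simp only [← hx]

end VectorValued

end FoldedSphere

end

theorem mainTheorem7_general {ι 𝕜 : Type*} [Countable ι] [RCLike 𝕜] (d : ℕ)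
    (κ τ : Fin (d + 1) → ℝ) (p q : ℝ) (hκ : ∀ i, 0 ≤ κ i) (hp : 1 < p) (hq : 1 < q)
    (hτ : ∀ i, -(1 / 2) < τ i ∧ τ i < p * κ i + (p - 1) / 2) :
    ∃ c : ℝ≥0, ∀ f : ι → UnitSphere d → 𝕜,
      (∀ j, AEStronglyMeasurable (f j) (surfaceMeasure d)) →
      weightedNorm τ p (fun x => (∑' j, intertwiningMaximal κ (f j) x ^ q) ^ (1 / q)) ≤
        c * weightedNorm τ p (fun x => (∑' j, ‖f j x‖ₑ ^ q) ^ (1 / q)) := by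
  have hp0 : 0 ≤ 1 / p := by positivity
  obtain ⟨C, hC⟩ :=
    FoldedSphere.exists_lintegral_lqNorm_intertwiningMaximal_le (ι := ι) (𝕜 := 𝕜) hp hq hκ hτ
  refine ⟨C ^ (1 / p), fun f hf => (ENNReal.rpow_le_rpow (hC f hf) hp0).trans_eq ?_⟩
  rw [ENNReal.mul_rpow_of_nonneg _ _ hp0, ENNReal.coe_rpow_of_nonneg _ hp0]
  rfl

theorem mainTheorem7 {𝕜 : Type*} [RCLike 𝕜] (d : ℕ) (κ τ : Fin (d + 1) → ℝ) (p : ℝ)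
    (hκ : ∀ i, 0 ≤ κ i) (hp : 1 < p)
    (hτ : ∀ i, -(1 / 2) < τ i ∧ τ i < p * κ i + (p - 1) / 2) :
    ∃ c : ℝ≥0, ∀ f : ℕ → UnitSphere d → 𝕜,
      (∀ j, AEStronglyMeasurable (f j) (surfaceMeasure d)) →
      weightedNorm τ p (fun x => (∑' j, intertwiningMaximal κ (f j) x ^ 2) ^ (1 / 2 : ℝ)) ≤
        c * weightedNorm τ p (fun x => (∑' j, ‖f j x‖ₑ ^ 2) ^ (1 / 2 : ℝ)) := by
  simpa only [ENNReal.rpow_two] using mainTheorem7_general d κ τ p 2 hκ hp one_lt_two hτ
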